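/- Let $n\ge 1$, $0<\lambda\le\Lambda$, $b_0\ge 0$, and let $B_r$ be the open ball of radius $r$ about $0$ in $\mathbb R^n$. For a symmetric matrix $M$ with eigenvalues $e_i$ put $\mathcal M^-_{\lambda,\Lambda}(M)=\lambda\sum_{e_i>0}e_i+\Lambda\sum_{e_i<0}e_i$. For $\rho>0$ and $f:B_1\to\mathbb R$, a function $u:B_1\to\mathbb R$ belongs to $\overline S_\rho(\lambda,\Lambda,b_0,f)$ if for all $x_0\in B_1$ and $\varphi\in C^2(B_1)$ with $\varphi(x_0)=u(x_0)$, $\varphi\le u$ near $x_0$, and $\|D^2\varphi(x_0)\|,|D\varphi(x_0)|,|\varphi(x_0)|\le\rho$ (where $\|\cdot\|$ is the operator norm), one has $$\mathcal M^-_{\lambda,\Lambda}(D^2\varphi(x_0))-b_0|D\varphi(x_0)|\le f(x_0).$$ Set $\Gamma=\frac{(n-1)\Lambda+2b_0+1}{\lambda}+1$ and $\rho_0=8\Gamma$, and write $\|g\|_\infty=\sup_{B_1}|g|$. Theorem (weak Harnack inequality). There are constants $\varepsilon_0>0$, depending only on $n,\lambda,\Lambda$, and $C>0$, depending only on $n,\lambda,\Lambda,b_0$,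 such that the following holds. Let $\rho\ge\rho_0$, let $f$ be bounded on $B_1$, and let $u\in\overline S_\rho(\lambda,\Lambda,b_0,f)$ be continuous and non-negative in $B_1$, with $$\|u\|_\infty\le\rho\qquad\text{and}\qquad \inf_{B_{1/4}}u+\frac{\|f\|_\infty}{8}\le\frac{\rho}{\rho_0}.$$ Let $u_\rho(x)=u(x)$ if $u(x)\le 17\rho/\rho_0$ and $u_\rho(x)=0$ if $u(x)>17\rho/\rho_0$. Then $$\|u_\rho\|_{L^{\varepsilon_0}(B_{1/4})}=\Big(\int_{B_{1/4}}|u_\rho|^{\varepsilon_0}\,dx\Big)^{1/\varepsilon_0}\le C\Big(\inf_{B_{1/4}}u+\|f\|_\infty\Big).$$ -/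

import Mathlib

open MeasureTheory Metric Topology

/-- The second derivative `D²φ(x)`, as a bilinear form; its norm is the operator (spectral) norm. -/
noncomputable def secondDeriv {n : ℕ} (φ : EuclideanSpace ℝ (Fin n) → ℝ)
    (x : EuclideanSpace ℝ (Fin n)) :
    EuclideanSpace ℝ (Fin n) →L[ℝ] EuclideanSpace ℝ (Fin n) →L[ℝ] ℝ :=
  fderiv ℝ (fderiv ℝ φ) x

/-- The Hessian matrix of `φ` at `x` in the standard basis. -/
noncomputable def hessianMatrix {n : ℕ} (φ : EuclideanSpace ℝ (Fin n) → ℝ)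
    (x : EuclideanSpace ℝ (Fin n)) : Matrix (Fin n) (Fin n) ℝ :=
  Matrix.of fun i j =>
    secondDeriv φ x (EuclideanSpace.single i (1 : ℝ)) (EuclideanSpace.single j (1 : ℝ))

/-- Pucci's minimal operator
`M⁻(A) = lam * (sum of the positive eigenvalues) + Lam * (sum of the negative eigenvalues)`,
the eigenvalues being the roots of the characteristic polynomial, with multiplicity. -/
noncomputable def pucciMin {n : ℕ} (lam Lam : ℝ) (A : Matrix (Fin n) (Fin n) ℝ) : ℝ :=
  lam * (A.charpoly.roots.filter (fun e => 0 < e)).sum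
    + Lam * (A.charpoly.roots.filter (fun e => e < 0)).sum

/-- For a symmetric matrix, `pucciMin` is the usual expression in its eigenvalues. -/
theorem pucciMin_eq_of_isHermitian {n : ℕ} (lam Lam : ℝ) {A : Matrix (Fin n) (Fin n) ℝ}
    (hA : A.IsHermitian) :
    pucciMin lam Lam A
      = lam * (∑ i ∈ Finset.univ.filter (fun i => 0 < hA.eigenvalues i), hA.eigenvalues i)
        + Lam * (∑ i ∈ Finset.univ.filter (fun i => hA.eigenvalues i < 0), hA.eigenvalues i) := by
  have h : A.charpoly.roots = Multiset.map hA.eigenvalues Finset.univ.val := by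
    have := hA.roots_charpoly_eq_eigenvalues
    simpa using this
  rw [pucciMin, h, Multiset.filter_map, Multiset.filter_map]
  rfl

/-- The class `S̄_ρ(lam, Lam, b₀, f)` of local Pucci supersolutions in the unit ball. -/
def IsPucciSupersolution {n : ℕ} (ρ lam Lam b₀ : ℝ)
    (f u : EuclideanSpace ℝ (Fin n) → ℝ) : Prop :=
  ∀ x₀ ∈ ball (0 : EuclideanSpace ℝ (Fin n)) 1,
    ∀ φ : EuclideanSpace ℝ (Fin n) → ℝ,
      ContDiffOn ℝ 2 φ (ball (0 : EuclideanSpace ℝ (Fin n)) 1) →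
      φ x₀ = u x₀ →
      (∀ᶠ x in 𝓝 x₀, φ x ≤ u x) →
      ‖secondDeriv φ x₀‖ ≤ ρ → ‖fderiv ℝ φ x₀‖ ≤ ρ → |φ x₀| ≤ ρ →
      pucciMin lam Lam (hessianMatrix φ x₀) - b₀ * ‖fderiv ℝ φ x₀‖ ≤ f x₀

/-- The constant `Γ = ((n - 1) Lam + 2 b₀ + 1) / lam + 1`. -/
noncomputable def pucciGamma (n : ℕ) (lam Lam b₀ : ℝ) : ℝ :=
  (((n : ℝ) - 1) * Lam + 2 * b₀ + 1) / lam + 1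

/-- The threshold `ρ₀ = 8 Γ`. -/
noncomputable def pucciRho₀ (n : ℕ) (lam Lam b₀ : ℝ) : ℝ :=
  8 * pucciGamma n lam Lam b₀

/-- The supremum norm of `f` on the unit ball (meaningful when `f` is bounded there). -/
noncomputable def supNormUnitBall {n : ℕ} (f : EuclideanSpace ℝ (Fin n) → ℝ) : ℝ :=
  sSup ((fun x => |f x|) '' ball (0 : EuclideanSpace ℝ (Fin n)) 1)

/-- The infimum of `u` over the ball of radius `1/4`. -/
noncomputable def infQuarterBall {n : ℕ} (u : EuclideanSpace ℝ (Fin n) → ℝ) : ℝ :=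
  sInf (u '' ball (0 : EuclideanSpace ℝ (Fin n)) (1 / 4))

/-- The truncation of `u` at level `t`: values above `t` are replaced by `0`. -/
noncomputable def truncAbove {n : ℕ} (t : ℝ) (u : EuclideanSpace ℝ (Fin n) → ℝ) :
    EuclideanSpace ℝ (Fin n) → ℝ :=
  fun x => if u x ≤ t then u x else 0

/-! The proof slides paraboloids of opening `a` from below and follows the contact set as `a` grows
geometrically. The usual area formula, which needs second derivatives of `u` at contact points, is
replaced by a barrier. If `u` lies above a paraboloid on a large ball and exceeds it by `K * a * s ^
2` on a ball of radius `s`, adding a Gaussian bump shows that `u` cannot touch it within `32 * s`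
(`IsPucciSupersolution.exists_hasBarrier`). The test functions have size at most `L * a`, which is
admissible while `L * a ≤ ρ`.

The barrier has two consequences. Nearby contact points have nearby vertices
(`HasBarrier.dist_vertex_le`), so a ball of vertices forces a contact set of comparable measure. It
also produces points where `u` is close to the paraboloid near any contact point. Together they show
that near each non-contact point a fixed fraction of the space is gained when `a` becomes `(1 + K) *
a`; a Vitali covering turns this into geometric decay of the non-contact set.

Since `u` is at most a multiple of `a` on the contact set, the superlevel sets of `u` decay too. A
chain of small balls carries this to the quarter ball, and summing over levels bounds the integral.
Working at scale `S` with `b * S ≤ 1` keeps the decay rate, and hence the exponent, independent of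
`b`; levels above `ρ` are empty because `u ≤ ρ`. -/

/-! ### Lower bounds for the Pucci operator. -/

theorem le_pucciMin_of_eigenvalues_ge {n : ℕ} {lam Lam γ : ℝ} (hLam : lam ≤ Lam)
    (hγ : 0 ≤ γ) {A : Matrix (Fin n) (Fin n) ℝ} (hA : A.IsHermitian)
    (h : ∀ i, -γ ≤ hA.eigenvalues i) :
    lam * A.trace - (Lam - lam) * n * γ ≤ pucciMin lam Lam A := by
  have htr : A.trace = ∑ i, hA.eigenvalues i := by
    simpa using hA.trace_eq_sum_eigenvalues
  have hn : (Lam - lam) * n * γ = ∑ _i : Fin n, (Lam - lam) * γ := by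
    simp; ring
  rw [pucciMin_eq_of_isHermitian lam Lam hA, htr, hn, Finset.sum_filter, Finset.sum_filter,
    Finset.mul_sum, Finset.mul_sum, Finset.mul_sum, ← Finset.sum_sub_distrib,
    ← Finset.sum_add_distrib]
  refine Finset.sum_le_sum fun i _ => ?_
  have hi := h i
  set e := hA.eigenvalues i
  split_ifs with h1 h2 h2
  · linarith
  · nlinarith [mul_nonneg (sub_nonneg.2 hLam) hγ]
  · nlinarith [mul_nonneg (sub_nonneg.2 hLam) (by linarith : 0 ≤ e + γ)]
  · have : e = 0 := le_antisymm (not_lt.1 h1) (not_lt.1 h2)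
    rw [this]; nlinarith [mul_nonneg (sub_nonneg.2 hLam) hγ]

/-- The Hessian of the barrier has this form: a positive rank-one part minus a multiple of the
identity. All eigenvalues are at least `-γ`, so the trace alone controls the operator. -/
theorem le_pucciMin_rankOne_sub {n : ℕ} {lam Lam γ τ : ℝ} (hLam : lam ≤ Lam) (hγ : 0 ≤ γ)
    (hτ : 0 ≤ τ) (w : EuclideanSpace ℝ (Fin n)) {A : Matrix (Fin n) (Fin n) ℝ}
    (hA : ∀ i j, A i j = τ * (w i * w j) - γ * (if i = j then 1 else 0)) :
    lam * τ * ‖w‖ ^ 2 - Lam * n * γ ≤ pucciMin lam Lam A := by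
  have hH : A.IsHermitian := by
    ext i j
    simp only [Matrix.conjTranspose_apply, hA, star_trivial, eq_comm (a := i) (b := j)]
    ring
  have hmul : ∀ v : Fin n → ℝ, A.mulVec v = (τ * (w.ofLp ⬝ᵥ v)) • w.ofLp - γ • v := by
    intro v
    ext i
    simp only [Matrix.mulVec, dotProduct, hA, sub_mul, Finset.sum_sub_distrib, Pi.sub_apply,
      Pi.smul_apply, smul_eq_mul]
    congr 1
    · rw [Finset.mul_sum, Finset.sum_mul]
      exact Finset.sum_congr rfl fun j _ => by ring
    · simp
  have hev : ∀ i, -γ ≤ hH.eigenvalues i := by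
    intro i
    have h1 := hH.eigenvalues_eq i
    set v : Fin n → ℝ := (hH.eigenvectorBasis i).ofLp with hv
    have h2 : v ⬝ᵥ v = 1 := by
      have := hH.eigenvectorBasis.orthonormal.1 i
      have h3 := real_inner_self_eq_norm_sq (hH.eigenvectorBasis i)
      rw [this] at h3
      rw [EuclideanSpace.inner_eq_star_dotProduct] at h3
      simpa using h3
    rw [h1, hmul]
    simp only [star_trivial, dotProduct_sub, dotProduct_smul, smul_eq_mul, h2, RCLike.re_to_real]
    rw [dotProduct_comm v]
    nlinarith [mul_nonneg hτ (mul_self_nonneg (w.ofLp ⬝ᵥ v))]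
  have htr : A.trace = τ * ‖w‖ ^ 2 - n * γ := by
    simp only [Matrix.trace, Matrix.diag_apply, hA, EuclideanSpace.real_norm_sq_eq, if_true,
      Finset.sum_sub_distrib, Finset.mul_sum]
    congr 1
    · exact Finset.sum_congr rfl fun j _ => by ring
    · simp
  have := le_pucciMin_of_eigenvalues_ge hLam hγ hH hev
  rw [htr] at this
  linarith

/-! ### Derivatives of the Gaussian barrier. -/

section Barrier

variable {n : ℕ}

/-- A concave paraboloid of opening `a` and vertex `y` plus a Gaussian bump centred at `c`. -/
noncomputable def gaussianBarrier (k a β q : ℝ) (y c : EuclideanSpace ℝ (Fin n))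
    (x : EuclideanSpace ℝ (Fin n)) : ℝ :=
  k - a / 2 * ‖x - y‖ ^ 2 + β * Real.exp (-q * ‖x - c‖ ^ 2)

theorem contDiff_gaussianBarrier (k a β q : ℝ) (y c : EuclideanSpace ℝ (Fin n)) :
    ContDiff ℝ 2 (gaussianBarrier k a β q y c) := by
  unfold gaussianBarrier
  have h1 : ContDiff ℝ 2 fun x : EuclideanSpace ℝ (Fin n) => ‖x - y‖ ^ 2 :=
    (contDiff_id.sub contDiff_const).norm_sq ℝ
  have h2 : ContDiff ℝ 2 fun x : EuclideanSpace ℝ (Fin n) => ‖x - c‖ ^ 2 :=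
    (contDiff_id.sub contDiff_const).norm_sq ℝ
  fun_prop

theorem fderiv_gaussianBarrier (k a β q : ℝ) (y c x : EuclideanSpace ℝ (Fin n)) :
    fderiv ℝ (gaussianBarrier k a β q y c) x =
      -a • innerSL ℝ (x - y)
        + (-2 * q * β * Real.exp (-q * ‖x - c‖ ^ 2)) • innerSL ℝ (x - c) := by
  have h1 := ((hasFDerivAt_id (𝕜 := ℝ) x).sub_const y).norm_sq
  have h2 := ((hasFDerivAt_id (𝕜 := ℝ) x).sub_const c).norm_sq
  have h3 := ((h1.const_mul (a / 2)).const_sub k).add (((h2.const_mul (-q)).exp).const_mul β)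
  have h4 : HasFDerivAt (gaussianBarrier k a β q y c) _ x := h3
  rw [h4.fderiv]
  ext v
  simp
  ring

theorem secondDeriv_gaussianBarrier_apply (k a β q : ℝ) (y c x v w : EuclideanSpace ℝ (Fin n)) :
    secondDeriv (gaussianBarrier k a β q y c) x v w =
      -a * inner ℝ v w + β * Real.exp (-q * ‖x - c‖ ^ 2) *
        (4 * q ^ 2 * (inner ℝ (x - c) v * inner ℝ (x - c) w) - 2 * q * inner ℝ v w) := by
  have hf : fderiv ℝ (gaussianBarrier k a β q y c) = fun x => -a • innerSL ℝ (x - y)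
        + (-2 * q * β * Real.exp (-q * ‖x - c‖ ^ 2)) • innerSL ℝ (x - c) :=
    funext fun x => fderiv_gaussianBarrier k a β q y c x
  have h1 : HasFDerivAt (fun x : EuclideanSpace ℝ (Fin n) => innerSL ℝ (x - y)) (innerSL ℝ) x := by
    exact (innerSL ℝ (E := EuclideanSpace ℝ (Fin n))).hasFDerivAt.comp x
      ((hasFDerivAt_id (𝕜 := ℝ) x).sub_const y)
  have h1' : HasFDerivAt (fun x : EuclideanSpace ℝ (Fin n) => innerSL ℝ (x - c)) (innerSL ℝ) x := by
    exact (innerSL ℝ (E := EuclideanSpace ℝ (Fin n))).hasFDerivAt.comp x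
      ((hasFDerivAt_id (𝕜 := ℝ) x).sub_const c)
  have h2 := ((hasFDerivAt_id (𝕜 := ℝ) x).sub_const c).norm_sq
  have h3 := (h1.const_smul (-a)).add
    ((((h2.const_mul (-q)).exp).const_mul (-2 * q * β)).smul h1')
  have h4 : HasFDerivAt (fun x => -a • innerSL ℝ (x - y)
        + (-2 * q * β * Real.exp (-q * ‖x - c‖ ^ 2)) • innerSL ℝ (x - c)) _ x := h3
  rw [secondDeriv, hf, h4.fderiv]
  have h5 : ∀ v w : EuclideanSpace ℝ (Fin n), innerSL ℝ v w = inner ℝ v w := fun _ _ => rfl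
  simp [h5, inner_sub_left]
  ring

theorem norm_fderiv_gaussianBarrier_le {k a β q : ℝ} (ha : 0 ≤ a) (hβ : 0 ≤ β) (hq : 0 ≤ q)
    (y c x : EuclideanSpace ℝ (Fin n)) :
    ‖fderiv ℝ (gaussianBarrier k a β q y c) x‖ ≤
      a * ‖x - y‖ + 2 * (β * q * Real.exp (-q * ‖x - c‖ ^ 2)) * ‖x - c‖ := by
  rw [fderiv_gaussianBarrier]
  refine (norm_add_le _ _).trans (add_le_add ?_ ?_)
  · rw [norm_smul, innerSL_apply_norm, norm_neg, Real.norm_of_nonneg ha]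
  · rw [norm_smul, innerSL_apply_norm]
    refine le_of_eq ?_
    congr 1
    rw [show -2 * q * β * Real.exp (-q * ‖x - c‖ ^ 2)
      = -(2 * (β * q * Real.exp (-q * ‖x - c‖ ^ 2))) by ring, norm_neg, Real.norm_of_nonneg]
    positivity

theorem norm_secondDeriv_gaussianBarrier_le {k a β q : ℝ} (ha : 0 ≤ a) (hβ : 0 ≤ β) (hq : 0 ≤ q)
    (y c x : EuclideanSpace ℝ (Fin n)) :
    ‖secondDeriv (gaussianBarrier k a β q y c) x‖ ≤
      a + β * Real.exp (-q * ‖x - c‖ ^ 2) * (4 * q ^ 2 * ‖x - c‖ ^ 2 + 2 * q) := by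
  refine ContinuousLinearMap.opNorm_le_bound₂ _ (by positivity) fun v w => ?_
  rw [secondDeriv_gaussianBarrier_apply]
  have h1 := abs_real_inner_le_norm v w
  have h2 := abs_real_inner_le_norm (x - c) v
  have h3 := abs_real_inner_le_norm (x - c) w
  have h4 : |inner ℝ (x - c) v * inner ℝ (x - c) w| ≤ ‖x - c‖ ^ 2 * (‖v‖ * ‖w‖) := by
    rw [abs_mul]
    calc _ ≤ (‖x - c‖ * ‖v‖) * (‖x - c‖ * ‖w‖) := by gcongr
      _ = _ := by ring
  set e := Real.exp (-q * ‖x - c‖ ^ 2) with he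
  have he0 : 0 ≤ e := (Real.exp_pos _).le
  rw [Real.norm_eq_abs]
  calc |-a * inner ℝ v w + β * e *
        (4 * q ^ 2 * (inner ℝ (x - c) v * inner ℝ (x - c) w) - 2 * q * inner ℝ v w)|
      ≤ a * |inner ℝ v w| + β * e *
        (4 * q ^ 2 * |inner ℝ (x - c) v * inner ℝ (x - c) w| + 2 * q * |inner ℝ v w|) := by
        refine (abs_add_le _ _).trans (add_le_add ?_ ?_)
        · rw [abs_mul, abs_neg, abs_of_nonneg ha]
        · rw [abs_mul, abs_of_nonneg (by positivity : 0 ≤ β * e)]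
          refine mul_le_mul_of_nonneg_left ((abs_sub _ _).trans ?_) (by positivity)
          rw [abs_mul, abs_mul (2 * q), abs_of_nonneg (by positivity : 0 ≤ 4 * q ^ 2),
            abs_of_nonneg (by positivity : 0 ≤ 2 * q)]
    _ ≤ a * (‖v‖ * ‖w‖) + β * e *
        (4 * q ^ 2 * (‖x - c‖ ^ 2 * (‖v‖ * ‖w‖)) + 2 * q * (‖v‖ * ‖w‖)) := by gcongr
    _ = _ := by ring

theorem le_pucciMin_gaussianBarrier {lam Lam k a β q : ℝ} (hLam : lam ≤ Lam)
    (ha : 0 ≤ a) (hβ : 0 ≤ β) (hq : 0 ≤ q) (y c x : EuclideanSpace ℝ (Fin n)) :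
    lam * (β * Real.exp (-q * ‖x - c‖ ^ 2) * (4 * q ^ 2)) * ‖x - c‖ ^ 2
      - Lam * n * (a + β * Real.exp (-q * ‖x - c‖ ^ 2) * (2 * q))
      ≤ pucciMin lam Lam (hessianMatrix (gaussianBarrier k a β q y c) x) := by
  refine le_pucciMin_rankOne_sub hLam (by positivity) (by positivity) (x - c) fun i j => ?_
  rw [hessianMatrix, Matrix.of_apply, secondDeriv_gaussianBarrier_apply]
  simp only [EuclideanSpace.inner_single_right, PiLp.single_apply, one_mul,
    eq_comm (a := j) (b := i), conj_trivial]
  ring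

end Barrier

/-! ### The barrier property for supersolutions. -/

/-- Paraboloids of opening `a` with vertex in `closedBall z S` lying below `u` satisfy a
quantitative strong maximum principle: if `u` exceeds the paraboloid by `K * a * s ^ 2` on a ball
of radius `s`, then `u` stays strictly above it on the ball of radius `32 * s`. -/
def HasBarrier {n : ℕ} (K : ℝ) (u : EuclideanSpace ℝ (Fin n) → ℝ)
    (z : EuclideanSpace ℝ (Fin n)) (S a : ℝ) : Prop :=
  ∀ (c y : EuclideanSpace ℝ (Fin n)) (k s : ℝ), y ∈ closedBall z S → 0 < s →
    dist c z + 48 * s ≤ S →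
    (∀ x ∈ closedBall c (48 * s), k - a / 2 * ‖x - y‖ ^ 2 ≤ u x) →
    (∀ x ∈ closedBall c s, k - a / 2 * ‖x - y‖ ^ 2 + K * a * s ^ 2 ≤ u x) →
    ∀ x ∈ closedBall c (32 * s), k - a / 2 * ‖x - y‖ ^ 2 < u x

-- If the conclusion failed, the barrier, shifted vertically, would touch `u` from below at a point
-- of the open annulus between radii `s` and `48 * s`, where it is a strict subsolution. Because `b
-- * S ≤ 1`, the drift is absorbed with constants free of `b`.
set_option maxHeartbeats 1000000 in
theorem IsPucciSupersolution.exists_hasBarrier (n : ℕ) {lam Lam : ℝ} (hlam : 0 < lam)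
    (hLam : lam ≤ Lam) :
    ∃ K L : ℝ, 1 ≤ K ∧ 0 < L ∧ ∀ (ρ b F S a : ℝ) (f u : EuclideanSpace ℝ (Fin n) → ℝ)
      (z : EuclideanSpace ℝ (Fin n)),
      0 ≤ b → IsPucciSupersolution ρ lam Lam b f u →
      ContinuousOn u (closedBall z S) → closedBall z S ⊆ ball 0 1 → S ≤ 1 → b * S ≤ 1 →
      (∀ x ∈ closedBall z S, |u x| ≤ ρ) → (∀ x ∈ closedBall z S, f x ≤ F) →
      0 < a → F ≤ a → L * a ≤ ρ → HasBarrier K u z S a := by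
  have hLam0 : 0 < Lam := hlam.trans_le hLam
  -- The rank-one part of the bump's Hessian must beat its negative part (`2 * Lam * n`) and its
  -- drift (`96`), with one unit left over.
  set α : ℝ := (2 * Lam * n + 97) / (4 * lam) + 1 with hα
  have hα1 : 1 ≤ α := by
    have : 0 ≤ (2 * Lam * n + 97) / (4 * lam) := by positivity
    linarith
  have hα0 : 0 < α := by linarith
  have hαlam : 2 * Lam * n + 97 ≤ 4 * lam * α := by
    rw [hα, mul_add, mul_div_cancel₀ _ (by positivity)]
    linarith
  set E₀ : ℝ := Real.exp (-(2304 * α)) with hE₀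
  have hE₀pos : 0 < E₀ := Real.exp_pos _
  have hE₀1 : E₀ ≤ 1 := Real.exp_le_one_iff.2 (by linarith)
  -- The leftover unit of the bump must beat the paraboloid's Hessian (`Lam * n`), its drift (`2`)
  -- and the right-hand side (`1`), even where the Gaussian has its smallest value `E₀`, at distance
  -- `48 * s`.
  set K : ℝ := (Lam * n + 4) / E₀ with hK
  have hKE : K * E₀ = Lam * n + 4 := div_mul_cancel₀ _ hE₀pos.ne'
  have hLn : 0 ≤ Lam * n := by positivity
  have hK1 : 1 ≤ K := by
    rw [hK, le_div_iff₀ hE₀pos]; linarith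
  have hK0 : 0 < K := by linarith
  -- `L * a` dominates both the Hessian and the gradient of the barrier; `9216 = 4 * 48 ^ 2`.
  refine ⟨K, 2 + K * (9216 * α ^ 2 + 96 * α), hK1, by positivity, ?_⟩
  intro ρ b F S a f u z hb hu huc hS hS1 hbS huρ hfF ha hFa haρ c y k s hy hs hcs h48 h1 x₁ hx₁
  have hsub : closedBall c (48 * s) ⊆ closedBall z S :=
    closedBall_subset_closedBall' (by linarith)
  have hsS : s ≤ S := by linarith [dist_nonneg (x := c) (y := z)]
  by_contra! hx₁u
  set q : ℝ := α / s ^ 2 with hq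
  have hqs : q * s ^ 2 = α := div_mul_cancel₀ _ (by positivity)
  have hq0 : 0 < q := by positivity
  set β : ℝ := K * a * s ^ 2 with hβ
  have hβ0 : 0 < β := by positivity
  have hβq : β * q = K * a * α := by rw [← hqs, hβ]; ring
  -- With this shift the barrier equals the paraboloid on the sphere of radius `48 * s` and lies
  -- above it inside.
  set k' : ℝ := k - β * E₀ with hk'
  set φ := gaussianBarrier k' a β q y c with hφ
  have hφc : Continuous φ := (contDiff_gaussianBarrier k' a β q y c).continuous
  have hx₁Ω : x₁ ∈ closedBall c (48 * s) := closedBall_subset_closedBall (by linarith) hx₁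
  obtain ⟨x₀, hx₀, hmin⟩ := (isCompact_closedBall c (48 * s)).exists_isMinOn ⟨x₁, hx₁Ω⟩
    ((huc.mono hsub).fun_sub hφc.continuousOn)
  replace hmin : ∀ x ∈ closedBall c (48 * s), u x₀ - φ x₀ ≤ u x - φ x := fun x hx => hmin hx
  have hφa : ∀ x, φ x = k' - a / 2 * ‖x - y‖ ^ 2 + β * Real.exp (-q * ‖x - c‖ ^ 2) := fun _ => rfl
  have hneg : u x₀ - φ x₀ < 0 := by
    refine (hmin x₁ hx₁Ω).trans_lt ?_
    have hd : ‖x₁ - c‖ ≤ 32 * s := by simpa [dist_eq_norm] using hx₁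
    have : E₀ < Real.exp (-q * ‖x₁ - c‖ ^ 2) := by
      rw [hE₀, Real.exp_lt_exp]
      have : q * ‖x₁ - c‖ ^ 2 ≤ q * (32 * s) ^ 2 := by gcongr
      nlinarith
    have := mul_lt_mul_of_pos_left this hβ0
    rw [hφa, hk']
    linarith
  have hin : s < ‖x₀ - c‖ := by
    by_contra! h
    have h2 := h1 x₀ (by simpa [dist_eq_norm] using h)
    have h3 : Real.exp (-q * ‖x₀ - c‖ ^ 2) ≤ 1 := Real.exp_le_one_iff.2 (by
      have : 0 ≤ q * ‖x₀ - c‖ ^ 2 := by positivity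
      linarith)
    have h4 := mul_le_mul_of_nonneg_left h3 hβ0.le
    have h5 : 0 < β * E₀ := by positivity
    rw [hφa, hk'] at hneg
    linarith
  have hx₀48 : ‖x₀ - c‖ ≤ 48 * s := by simpa [dist_eq_norm] using hx₀
  have hE : E₀ ≤ Real.exp (-q * ‖x₀ - c‖ ^ 2) := by
    rw [hE₀, Real.exp_le_exp]
    have : q * ‖x₀ - c‖ ^ 2 ≤ q * (48 * s) ^ 2 := by gcongr
    nlinarith
  have hout : ‖x₀ - c‖ < 48 * s := by
    refine lt_of_le_of_ne hx₀48 fun h => ?_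
    have h2 := h48 x₀ hx₀
    have h4 : Real.exp (-q * ‖x₀ - c‖ ^ 2) = E₀ := by rw [h, hE₀, ← hqs]; ring_nf
    rw [hφa, hk', h4] at hneg
    linarith
  have hE1 : Real.exp (-q * ‖x₀ - c‖ ^ 2) ≤ 1 := Real.exp_le_one_iff.2 (by
    have : 0 ≤ q * ‖x₀ - c‖ ^ 2 := by positivity
    linarith)
  set E := Real.exp (-q * ‖x₀ - c‖ ^ 2) with hEdef
  have hEpos : 0 < E := Real.exp_pos _
  set m := u x₀ - φ x₀ with hm
  have hψ : gaussianBarrier (k' + m) a β q y c = fun x => φ x + m := by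
    funext x; simp only [hφ, gaussianBarrier]; ring
  have hyx : ‖x₀ - y‖ ≤ 2 * S := by
    have h2 : dist x₀ z ≤ S := hsub hx₀
    have h3 : dist y z ≤ S := hy
    rw [← dist_eq_norm]
    linarith [dist_triangle_right x₀ y z]
  have hv1 : s ^ 2 ≤ ‖x₀ - c‖ ^ 2 := by gcongr
  have hv2 : ‖x₀ - c‖ ^ 2 ≤ (48 * s) ^ 2 := by gcongr
  have hq2 : β * q ^ 2 * s ^ 2 = K * a * α ^ 2 := by
    calc β * q ^ 2 * s ^ 2 = (β * q) * (q * s ^ 2) := by ring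
      _ = _ := by rw [hβq, hqs]; ring
  have hgrad := norm_fderiv_gaussianBarrier_le (k := k' + m) ha.le hβ0.le hq0.le y c x₀
  have hhess := norm_secondDeriv_gaussianBarrier_le (k := k' + m) ha.le hβ0.le hq0.le y c x₀
  have hpuc := le_pucciMin_gaussianBarrier (lam := lam) (k := k' + m) hLam ha.le hβ0.le hq0.le
    y c x₀
  rw [← hEdef] at hgrad hhess hpuc
  rw [hβq] at hgrad
  have hKa : 0 < K * a := by positivity
  have hgrad' : ‖fderiv ℝ (gaussianBarrier (k' + m) a β q y c) x₀‖
      ≤ a * (2 * S) + 2 * (K * a * α * E) * (48 * s) := by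
    refine hgrad.trans ?_
    gcongr
  have hLa : (2 + K * (9216 * α ^ 2 + 96 * α)) * a
      = 2 * a + 9216 * (K * a * α ^ 2) + 96 * (K * a * α) := by ring
  have key := hu x₀ (hS (hsub hx₀)) (gaussianBarrier (k' + m) a β q y c)
    (contDiff_gaussianBarrier _ _ _ _ _ _).contDiffOn
    (by rw [hψ]; simp only [hm]; ring)
    (by
      have : ball c (48 * s) ∈ 𝓝 x₀ := isOpen_ball.mem_nhds (by simpa [dist_eq_norm] using hout)
      filter_upwards [this] with x hx
      have h2 : u x₀ - φ x₀ ≤ u x - φ x := hmin x (ball_subset_closedBall hx)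
      rw [hψ]; simp only; linarith)
    (by
      refine hhess.trans (le_trans ?_ haρ)
      have h2 : β * E * (4 * q ^ 2 * ‖x₀ - c‖ ^ 2 + 2 * q)
          ≤ β * 1 * (4 * q ^ 2 * (48 * s) ^ 2 + 2 * q) := by gcongr
      have h3 : β * 1 * (4 * q ^ 2 * (48 * s) ^ 2 + 2 * q)
          = 9216 * (K * a * α ^ 2) + 2 * (K * a * α) := by
        rw [← hq2, ← hβq]; ring
      have h4 : 0 < K * a * α := by positivity
      linarith)
    (by
      refine hgrad'.trans (le_trans ?_ haρ)
      have h2 : a * (2 * S) + 2 * (K * a * α * E) * (48 * s)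
          ≤ a * (2 * 1) + 2 * (K * a * α * 1) * (48 * 1) := by
        gcongr
        exact hsS.trans hS1
      have h4 : 0 < K * a * α ^ 2 := by positivity
      have h5 : 2 * (K * a * α * 1) * (48 * 1) = 96 * (K * a * α) := by ring
      linarith)
    (by
      rw [hψ]; simp only [hm]
      have := huρ x₀ (hsub hx₀)
      simpa using this)
  have hfx := hfF x₀ (hsub hx₀)
  have hbgrad : b * ‖fderiv ℝ (gaussianBarrier (k' + m) a β q y c) x₀‖
      ≤ 2 * a + 96 * (K * a * α * E) := by
    have hbs : b * s ≤ 1 := (mul_le_mul_of_nonneg_left hsS hb).trans hbS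
    calc _ ≤ b * (a * (2 * S) + 2 * (K * a * α * E) * (48 * s)) := by gcongr
      _ = 2 * a * (b * S) + 96 * (K * a * α * E) * (b * s) := by ring
      _ ≤ 2 * a * 1 + 96 * (K * a * α * E) * 1 := by gcongr
      _ = _ := by ring
  have hmain : 4 * lam * (K * a * α ^ 2 * E) ≤ lam * (β * E * (4 * q ^ 2)) * ‖x₀ - c‖ ^ 2 := by
    rw [← hq2]
    calc 4 * lam * (β * q ^ 2 * s ^ 2 * E) = lam * (β * E * (4 * q ^ 2)) * s ^ 2 := by ring
      _ ≤ _ := by gcongr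
  have hcross : β * E * (2 * q) = 2 * (K * a * α * E) := by rw [← hβq]; ring
  rw [hcross] at hpuc
  have h5 : (2 * Lam * n + 97) * (K * a * α * E) ≤ 4 * lam * (K * a * α ^ 2 * E) := by
    calc _ ≤ 4 * lam * α * (K * a * α * E) := by gcongr
      _ = _ := by ring
  have h6 : (Lam * n + 4) * a ≤ K * a * α * E := by
    rw [← hKE]
    calc K * E₀ * a = K * a * 1 * E₀ := by ring
      _ ≤ _ := by gcongr
  have h7 : (2 * Lam * n + 97) * (K * a * α * E)
      = 2 * Lam * n * (K * a * α * E) + 97 * (K * a * α * E) := by ring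
  have h8 : Lam * n * (a + 2 * (K * a * α * E))
      = Lam * n * a + 2 * Lam * n * (K * a * α * E) := by ring
  have h9 : (Lam * n + 4) * a = Lam * n * a + 4 * a := by ring
  linarith

/-! ### Contact sets and the dependence of vertices on contact points. -/

section ContactSet

variable {n : ℕ}

/-- Points of `closedBall z S` at which some paraboloid of opening `a` and vertex in
`closedBall z S` touches `u` from below, over the whole of `closedBall z S`. -/
def contactSet (u : EuclideanSpace ℝ (Fin n) → ℝ) (z : EuclideanSpace ℝ (Fin n)) (S a : ℝ) :
    Set (EuclideanSpace ℝ (Fin n)) :=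
  {x | x ∈ closedBall z S ∧ ∃ y ∈ closedBall z S, ∀ x' ∈ closedBall z S,
    u x + a / 2 * ‖x - y‖ ^ 2 ≤ u x' + a / 2 * ‖x' - y‖ ^ 2}

theorem isCompact_contactSet {u : EuclideanSpace ℝ (Fin n) → ℝ} {z : EuclideanSpace ℝ (Fin n)}
    {S : ℝ} (hu : ContinuousOn u (closedBall z S)) (a : ℝ) : IsCompact (contactSet u z S a) := by
  set Ω := closedBall z S
  have hΩ : IsCompact (Ω ×ˢ Ω) := (isCompact_closedBall z S).prod (isCompact_closedBall z S)
  have hu' : ContinuousOn (fun p : EuclideanSpace ℝ (Fin n) × EuclideanSpace ℝ (Fin n) => u p.1)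
      (Ω ×ˢ Ω) := hu.comp continuousOn_fst fun p hp => hp.1
  have h1 : IsClosed {p | p ∈ Ω ×ˢ Ω ∧ ∀ x' ∈ Ω,
      u p.1 + a / 2 * ‖p.1 - p.2‖ ^ 2 ≤ u x' + a / 2 * ‖x' - p.2‖ ^ 2} := by
    have : {p | p ∈ Ω ×ˢ Ω ∧ ∀ x' ∈ Ω,
        u p.1 + a / 2 * ‖p.1 - p.2‖ ^ 2 ≤ u x' + a / 2 * ‖x' - p.2‖ ^ 2}
        = (Ω ×ˢ Ω) ∩ ⋂ x' ∈ Ω, {p | p ∈ Ω ×ˢ Ω ∧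
          u p.1 + a / 2 * ‖p.1 - p.2‖ ^ 2 ≤ u x' + a / 2 * ‖x' - p.2‖ ^ 2} := by
      ext p
      simp only [Set.mem_ofPred_eq, Set.mem_inter_iff, Set.mem_iInter]
      exact ⟨fun h => ⟨h.1, fun x' hx' => ⟨h.1, h.2 x' hx'⟩⟩,
        fun h => ⟨h.1, fun x' hx' => (h.2 x' hx').2⟩⟩
    rw [this]
    refine hΩ.isClosed.inter (isClosed_biInter fun x' _ => ?_)
    exact hΩ.isClosed.isClosed_le (hu'.add (by fun_prop)) (by fun_prop)
  have h2 : IsCompact {p | p ∈ Ω ×ˢ Ω ∧ ∀ x' ∈ Ω,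
      u p.1 + a / 2 * ‖p.1 - p.2‖ ^ 2 ≤ u x' + a / 2 * ‖x' - p.2‖ ^ 2} :=
    hΩ.of_isClosed_subset h1 fun p hp => hp.1
  convert h2.image continuous_fst using 1
  ext x
  constructor
  · rintro ⟨hx, y, hy, h⟩
    exact ⟨(x, y), ⟨⟨hx, hy⟩, h⟩, rfl⟩
  · rintro ⟨⟨x', y⟩, ⟨⟨hx, hy⟩, h⟩, rfl⟩
    exact ⟨hx, y, hy, h⟩

/-- Completing the square: penalising a given paraboloid around `y` gives a steeper paraboloid whose
vertex is a convex combination, hence still admissible. -/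
theorem half_mul_norm_sub_sq_add {a K : ℝ} (hK : 0 ≤ K) (x y₁ y : EuclideanSpace ℝ (Fin n)) :
    a / 2 * ‖x - y₁‖ ^ 2 + K * a / 2 * ‖x - y‖ ^ 2 =
      (1 + K) * a / 2 * ‖x - (1 + K)⁻¹ • (y₁ + K • y)‖ ^ 2
        + K * a / (2 * (1 + K)) * ‖y₁ - y‖ ^ 2 := by
  have h0 : (1 + K) ≠ 0 := by positivity
  have h1 : ∀ v w : EuclideanSpace ℝ (Fin n),
      ‖v - w‖ ^ 2 = inner ℝ v v - 2 * inner ℝ v w + inner ℝ w w := by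
    intro v w
    rw [norm_sub_sq_real, real_inner_self_eq_norm_sq, real_inner_self_eq_norm_sq]
  simp only [h1, inner_smul_left, inner_smul_right, inner_add_left, inner_add_right,
    real_inner_comm y y₁, conj_trivial]
  field_simp
  ring

theorem convexCombination_mem_closedBall {K S : ℝ} (hK : 0 ≤ K)
    {z y₁ y : EuclideanSpace ℝ (Fin n)} (h₁ : y₁ ∈ closedBall z S) (h : y ∈ closedBall z S) :
    (1 + K)⁻¹ • (y₁ + K • y) ∈ closedBall z S := by
  have h0 : (1 + K) ≠ 0 := by positivity
  have h1 : (0 : ℝ) ≤ (1 + K)⁻¹ := by positivity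
  have h2 : (0 : ℝ) ≤ (1 + K)⁻¹ * K := by positivity
  have := convex_closedBall z S h₁ h h1 h2 (by field_simp)
  rwa [smul_add, smul_smul]

theorem contactSet_subset {u : EuclideanSpace ℝ (Fin n) → ℝ} {z : EuclideanSpace ℝ (Fin n)}
    {S a K : ℝ} (ha : 0 ≤ a) (hK : 0 ≤ K) :
    contactSet u z S a ⊆ contactSet u z S ((1 + K) * a) := by
  rintro x ⟨hx, y, hy, h⟩
  refine ⟨hx, (1 + K)⁻¹ • (y + K • x), convexCombination_mem_closedBall hK hy hx,
    fun x' hx' => ?_⟩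
  have h1 := half_mul_norm_sub_sq_add (a := a) hK x y x
  have h2 := half_mul_norm_sub_sq_add (a := a) hK x' y x
  have h3 := h x' hx'
  have h4 : 0 ≤ K * a / 2 * ‖x' - x‖ ^ 2 := by positivity
  simp only [sub_self, norm_zero] at h1
  linarith

/-- Two paraboloids of equal opening differ by an affine function with slope `a * ‖y₁ - y₀‖`. If the
vertices were far apart, the second paraboloid, and so `u`, would exceed the first by `K * a * s ^
2` on a ball near `x₁`, and the barrier would forbid contact at `x₀`. -/
theorem HasBarrier.dist_vertex_le {K : ℝ} {u : EuclideanSpace ℝ (Fin n) → ℝ}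
    {z : EuclideanSpace ℝ (Fin n)} {S a : ℝ} (hB : HasBarrier K u z S a) (hK : 0 ≤ K) (ha : 0 < a)
    {x₀ x₁ y₀ y₁ : EuclideanSpace ℝ (Fin n)} (hy₀ : y₀ ∈ closedBall z S)
    (h₀ : ∀ x ∈ closedBall z S, u x₀ + a / 2 * ‖x₀ - y₀‖ ^ 2 ≤ u x + a / 2 * ‖x - y₀‖ ^ 2)
    (h₁ : ∀ x ∈ closedBall z S, u x₁ + a / 2 * ‖x₁ - y₁‖ ^ 2 ≤ u x + a / 2 * ‖x - y₁‖ ^ 2)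
    {s : ℝ} (hs : 0 < s) (hxs : dist x₀ x₁ ≤ s) (hsS : dist x₁ z + 50 * s ≤ S) :
    dist y₀ y₁ ≤ K * s := by
  by_contra! hlt
  rw [dist_comm, dist_eq_norm] at hlt
  set d := ‖y₁ - y₀‖ with hd
  have hd0 : 0 < d := lt_of_le_of_lt (by positivity) hlt
  -- At distance `2 * s` in the direction of growth, every point of the `s`-ball around `c` has
  -- advanced by at least `s` from `x₁`.
  set c := x₁ + (2 * s / d) • (y₁ - y₀) with hc
  have hcx : dist c x₁ = 2 * s := by
    rw [dist_eq_norm, hc, add_sub_cancel_left, norm_smul, ← hd, Real.norm_of_nonneg (by positivity)]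
    field_simp
  have hcz : dist c z + 48 * s ≤ S := by
    linarith [dist_triangle c x₁ z]
  have hsub : closedBall c (48 * s) ⊆ closedBall z S :=
    closedBall_subset_closedBall' (by linarith)
  have hx₁ : x₁ ∈ closedBall z S := by
    rw [mem_closedBall]; linarith
  have hsub' : closedBall c s ⊆ closedBall z S :=
    (closedBall_subset_closedBall (by linarith)).trans hsub
  have := hB c y₀ (u x₀ + a / 2 * ‖x₀ - y₀‖ ^ 2) s hy₀ hs hcz
    (fun x hx => by linarith [h₀ x (hsub hx)])
    (fun x hx => ?_) x₀ (by rw [mem_closedBall]; linarith [dist_triangle_right x₀ c x₁])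
  · linarith
  have e1 := h₁ x (hsub' hx)
  have e0 := h₀ x₁ hx₁
  have hin : (‖x - y₀‖ ^ 2 - ‖x - y₁‖ ^ 2) - (‖x₁ - y₀‖ ^ 2 - ‖x₁ - y₁‖ ^ 2)
      = 2 * inner ℝ (y₁ - y₀) (x - x₁) := by
    simp only [norm_sub_sq_real, inner_sub_left, inner_sub_right, real_inner_comm]
    ring
  have hin2 : inner ℝ (y₁ - y₀) (x - x₁) = inner ℝ (y₁ - y₀) (x - c) + 2 * s * d := by
    rw [show x - x₁ = (x - c) + (2 * s / d) • (y₁ - y₀) by rw [hc]; abel, inner_add_right,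
      inner_smul_right, real_inner_self_eq_norm_sq, ← hd]
    field_simp
  have hin3 : -(d * s) ≤ inner ℝ (y₁ - y₀) (x - c) := by
    have h5 := abs_real_inner_le_norm (y₁ - y₀) (x - c)
    have h6 : ‖x - c‖ ≤ s := by simpa [dist_eq_norm] using hx
    have h7 : d * ‖x - c‖ ≤ d * s := by gcongr
    linarith [neg_abs_le (inner ℝ (y₁ - y₀) (x - c))]
  have hfin : a * (K * s ^ 2) ≤ a * inner ℝ (y₁ - y₀) (x - x₁) := by
    refine mul_le_mul_of_nonneg_left ?_ ha.le
    have : K * s * s ≤ d * s := by gcongr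
    rw [hin2]
    nlinarith
  have hin' : a / 2 * ((‖x - y₀‖ ^ 2 - ‖x - y₁‖ ^ 2) - (‖x₁ - y₀‖ ^ 2 - ‖x₁ - y₁‖ ^ 2))
      = a * inner ℝ (y₁ - y₀) (x - x₁) := by rw [hin]; ring
  linarith

-- The inverse of `X` is `M`-Lipschitz, and `n`-dimensional Hausdorff measure is proportional to
-- volume. No measurability of `X` is needed.
open scoped NNReal in
theorem volume_le_of_antilipschitzOn {B : Set (EuclideanSpace ℝ (Fin n))}
    {X : EuclideanSpace ℝ (Fin n) → EuclideanSpace ℝ (Fin n)} {M : ℝ≥0}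
    (h : ∀ y ∈ B, ∀ y' ∈ B, dist y y' ≤ M * dist (X y) (X y')) :
    volume B ≤ (M : ENNReal) ^ n * volume (X '' B) := by
  have hinj : Set.InjOn X B := fun y hy y' hy' hyy => by
    have := h y hy y' hy'
    rw [hyy, dist_self, mul_zero] at this
    exact dist_le_zero.1 this
  set g := Function.invFunOn X B
  have hg : ∀ y ∈ B, g (X y) = y := fun y hy => hinj.leftInvOn_invFunOn hy
  have hlip : LipschitzOnWith M g (X '' B) := by
    refine LipschitzOnWith.of_dist_le_mul ?_
    rintro _ ⟨y, hy, rfl⟩ _ ⟨y', hy', rfl⟩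
    rw [hg y hy, hg y' hy']
    exact h y hy y' hy'
  have hgB : g '' (X '' B) = B := by
    rw [Set.image_image]
    exact (Set.image_congr hg).trans (Set.image_id' B)
  have h1 := hlip.hausdorffMeasure_image_le (d := n) (Nat.cast_nonneg n)
  rw [hgB, ENNReal.rpow_natCast] at h1
  have : (Measure.hausdorffMeasure n : Measure (EuclideanSpace ℝ (Fin n))).IsAddHaarMeasure := by
    have h2 := isAddHaarMeasure_hausdorffMeasure (E := EuclideanSpace ℝ (Fin n))
    rwa [finrank_euclideanSpace_fin] at h2
  have h3 := Measure.isAddLeftInvariant_eq_smul (volume : Measure (EuclideanSpace ℝ (Fin n)))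
    (Measure.hausdorffMeasure n)
  rw [h3]
  simp only [Measure.smul_apply, ENNReal.smul_def, smul_eq_mul]
  rw [mul_left_comm]
  gcongr

end ContactSet

/-! ### Growth of the contact set. -/

section Decay

variable {n : ℕ}

/-- The paraboloid touching at `x₁` is penalised around each `y` in a small ball near `x`. The new
contact points stay near `x`, and the map from `y` to the contact point is anti-Lipschitz, so they
fill a fixed fraction of the ball. -/
theorem HasBarrier.volume_closedBall_le {K : ℝ} {u : EuclideanSpace ℝ (Fin n) → ℝ}
    {z : EuclideanSpace ℝ (Fin n)} {R a : ℝ} (hK : 1 ≤ K) (ha : 0 < a) (hR : 0 < R)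
    (hu : ContinuousOn u (closedBall z (128 * R)))
    (hB : HasBarrier K u z (128 * R) a) (hB' : HasBarrier K u z (128 * R) ((1 + K) * a))
    {x x₁ : EuclideanSpace ℝ (Fin n)} {r : ℝ} (hx : x ∈ ball z R) (hr : 0 < r) (hrR : r < 2 * R)
    (hx₁ : x₁ ∈ contactSet u z (128 * R) a) (hxx₁ : dist x x₁ ≤ 2 * r) :
    volume (closedBall x (r / 24)) ≤ ENNReal.ofReal (1 + K) ^ n *
      volume (closedBall x (r / 2) ∩ ball z R ∩ contactSet u z (128 * R) ((1 + K) * a)) := by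
  have hK0 : 0 < K := by linarith
  obtain ⟨hx₁Ω, y₁, hy₁, hy₁min⟩ := hx₁
  set s := r / 12 with hs
  have hs0 : 0 < s := by positivity
  have hrs : r = 12 * s := by rw [hs]; ring
  -- Moving from `x` towards `z` makes room for a ball of radius `3 * s` inside both `ball z R` and
  -- `closedBall x (r / 2)`.
  set w := x + (r / (4 * R)) • (z - x) with hw
  have hxz : dist x z < R := hx
  have hwx : dist w x ≤ 3 * s := by
    rw [dist_eq_norm, hw, add_sub_cancel_left, norm_smul, ← dist_eq_norm, dist_comm,
      Real.norm_of_nonneg (by positivity), hrs, div_mul_eq_mul_div, div_le_iff₀ (by positivity)]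
    nlinarith
  have hwz : dist w z < R - 3 * s := by
    have h1 : w - z = (1 - r / (4 * R)) • (x - z) := by rw [hw]; module
    have h2 : r / (4 * R) ≤ 1 / 2 := by
      rw [div_le_iff₀ (by positivity)]; linarith
    rw [dist_eq_norm, h1, norm_smul, Real.norm_of_nonneg (by linarith), ← dist_eq_norm]
    calc (1 - r / (4 * R)) * dist x z < (1 - r / (4 * R)) * R := by
          apply mul_lt_mul_of_pos_left hxz; linarith
      _ = R - 3 * s := by rw [hrs]; field_simp; ring
  have hDx : closedBall w (3 * s) ⊆ closedBall x (r / 2) :=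
    closedBall_subset_closedBall' (by linarith)
  have hDB : closedBall w (3 * s) ⊆ ball z R := fun p hp => by
    have : dist p w ≤ 3 * s := hp
    rw [mem_ball]; linarith [dist_triangle p w z]
  have hBΩ : ball z R ⊆ closedBall z (128 * R) :=
    ball_subset_closedBall.trans (closedBall_subset_closedBall (by linarith))
  -- Otherwise the barrier would exclude contact at `x₁`, which is within `27 * s` of `w`.
  obtain ⟨x₂, hx₂, hx₂u⟩ : ∃ x₂ ∈ closedBall w s,
      u x₂ < u x₁ + a / 2 * ‖x₁ - y₁‖ ^ 2 - a / 2 * ‖x₂ - y₁‖ ^ 2 + K * a * s ^ 2 := by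
    by_contra! hcon
    have hsub : closedBall w (48 * s) ⊆ closedBall z (128 * R) :=
      closedBall_subset_closedBall' (by linarith)
    have := hB w y₁ (u x₁ + a / 2 * ‖x₁ - y₁‖ ^ 2) s hy₁ hs0 (by linarith)
      (fun p hp => by linarith [hy₁min p (hsub hp)]) hcon x₁
      (by rw [mem_closedBall]; linarith [dist_triangle_right x₁ w x, dist_comm x₁ x])
    linarith
  have hsD : closedBall w s ⊆ closedBall w (3 * s) := closedBall_subset_closedBall (by linarith)
  have hsD' : closedBall w (s / 2) ⊆ closedBall w (3 * s) :=
    closedBall_subset_closedBall (by linarith)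
  set Y : EuclideanSpace ℝ (Fin n) → EuclideanSpace ℝ (Fin n) :=
    fun y => (1 + K)⁻¹ • (y₁ + K • y) with hY
  have hYΩ : ∀ y ∈ closedBall w (s / 2), Y y ∈ closedBall z (128 * R) := fun y hy =>
    convexCombination_mem_closedBall hK0.le hy₁ (hBΩ (hDB (hsD' hy)))
  have hX : ∀ y : EuclideanSpace ℝ (Fin n), ∃ x ∈ closedBall z (128 * R),
      (∀ x' ∈ closedBall z (128 * R), u x + (1 + K) * a / 2 * ‖x - Y y‖ ^ 2
        ≤ u x' + (1 + K) * a / 2 * ‖x' - Y y‖ ^ 2) := by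
    intro y
    exact (isCompact_closedBall z (128 * R)).exists_isMinOn
      (f := fun x => u x + (1 + K) * a / 2 * ‖x - Y y‖ ^ 2) ⟨x₁, hx₁Ω⟩
      (hu.fun_add (by fun_prop))
  choose X hXΩ hXmin using hX
  -- Above the contact value, the penalised function is below `17 / 8 * K * a * s ^ 2` at `x₂`, but
  -- at least `25 / 8 * K * a * s ^ 2` outside this ball.
  have hXD : ∀ y ∈ closedBall w (s / 2), X y ∈ closedBall w (3 * s) := by
    intro y hy
    by_contra hout
    have h1 := hXmin y x₂ (hBΩ (hDB (hsD hx₂)))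
    have h2 := hy₁min (X y) (hXΩ y)
    have e1 := half_mul_norm_sub_sq_add (a := a) hK0.le (X y) y₁ y
    have e2 := half_mul_norm_sub_sq_add (a := a) hK0.le x₂ y₁ y
    have hyw : dist y w ≤ s / 2 := hy
    have hx₂w : dist x₂ w ≤ s := hx₂
    have h3 : ‖x₂ - y‖ ≤ 3 / 2 * s := by
      rw [← dist_eq_norm]; linarith [dist_triangle_right x₂ y w]
    have h4 : 5 / 2 * s ≤ ‖X y - y‖ := by
      have : 3 * s < dist (X y) w := not_le.1 hout
      rw [← dist_eq_norm]; linarith [dist_triangle (X y) y w]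
    have h5 : K * a / 2 * ‖x₂ - y‖ ^ 2 ≤ K * a / 2 * (3 / 2 * s) ^ 2 := by gcongr
    have h6 : K * a / 2 * (5 / 2 * s) ^ 2 ≤ K * a / 2 * ‖X y - y‖ ^ 2 := by gcongr
    have h7 : 0 < K * a * s ^ 2 := by positivity
    simp only [hY] at h1
    linarith
  have hanti : ∀ y ∈ closedBall w (s / 2), ∀ y' ∈ closedBall w (s / 2),
      dist y y' ≤ (1 + K).toNNReal * dist (X y) (X y') := by
    intro y hy y' hy'
    rw [Real.coe_toNNReal _ (by linarith)]
    by_contra! hlt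
    have hyy : dist y y' ≤ s := by
      have h1 : dist y w ≤ s / 2 := hy
      have h2 : dist y' w ≤ s / 2 := hy'
      linarith [dist_triangle_right y y' w]
    have h1 : dist (X y) (X y') < dist y y' / (1 + K) := by
      rw [lt_div_iff₀ (by linarith)]; linarith
    have h2 : dist y y' / (1 + K) ≤ dist y y' := div_le_self dist_nonneg (by linarith)
    -- The intermediate `t` supplies a positive radius even if `X y = X y'`.
    obtain ⟨t, ht1, ht2⟩ := exists_between h1
    have ht0 : 0 < t := lt_of_le_of_lt dist_nonneg ht1
    have hX' : dist (X y') z < R := hDB (hXD y' hy')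
    have h3 := hB'.dist_vertex_le hK0.le (by positivity) (hYΩ y hy) (hXmin y) (hXmin y')
      ht0 ht1.le (by linarith)
    have h4 : dist (Y y) (Y y') = K * (dist y y' / (1 + K)) := by
      have : Y y - Y y' = ((1 + K)⁻¹ * K) • (y - y') := by simp only [hY]; module
      rw [dist_eq_norm, this, norm_smul, ← dist_eq_norm, Real.norm_of_nonneg (by positivity)]
      ring
    rw [h4] at h3
    exact absurd (le_of_mul_le_mul_left h3 hK0) (not_le.2 ht2)
  have hvol := volume_le_of_antilipschitzOn hanti
  rw [Measure.addHaar_closedBall_center] at hvol ⊢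
  rw [show r / 24 = s / 2 by rw [hrs]; ring]
  refine hvol.trans ?_
  change ENNReal.ofReal (1 + K) ^ n * _ ≤ _
  gcongr
  rintro _ ⟨y, hy, rfl⟩
  exact ⟨⟨hDx (hXD y hy), hDB (hXD y hy)⟩, hXΩ y, Y y, hYΩ y hy, hXmin y⟩

/-- A Vitali covering with radii half the distance to the old contact set: the disjoint balls miss
that set, so the contact points found in them are new. -/
theorem HasBarrier.volume_diff_contactSet_le {K : ℝ} {u : EuclideanSpace ℝ (Fin n) → ℝ}
    {z : EuclideanSpace ℝ (Fin n)} {R a : ℝ} (hK : 1 ≤ K) (ha : 0 < a) (hR : 0 < R)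
    (hu : ContinuousOn u (closedBall z (128 * R)))
    (hB : HasBarrier K u z (128 * R) a) (hB' : HasBarrier K u z (128 * R) ((1 + K) * a))
    (hne : (ball z R ∩ contactSet u z (128 * R) a).Nonempty) :
    volume (ball z R \ contactSet u z (128 * R) a) ≤ ENNReal.ofReal (48 * (1 + K)) ^ n *
      volume ((ball z R \ contactSet u z (128 * R) a) ∩
        contactSet u z (128 * R) ((1 + K) * a)) := by
  set T := contactSet u z (128 * R) a
  set T' := contactSet u z (128 * R) ((1 + K) * a)
  set B := ball z R
  have hT : IsCompact T := isCompact_contactSet hu a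
  have hT' : IsCompact T' := isCompact_contactSet hu _
  set ρ : EuclideanSpace ℝ (Fin n) → ℝ := fun x => infDist x (B ∩ T) with hρ
  have hρpos : ∀ x ∈ B \ T, 0 < ρ x := by
    intro x hx
    refine lt_of_le_of_ne infDist_nonneg fun h => hx.2 ?_
    have := (mem_closure_iff_infDist_zero hne).2 h.symm
    exact (closure_minimal Set.inter_subset_right hT.isClosed) this
  have hρlt : ∀ x ∈ B \ T, ρ x < 2 * R := by
    intro x hx
    obtain ⟨p, hp⟩ := hne
    have h1 : dist x z < R := hx.1
    have h2 : dist p z < R := hp.1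
    have h3 : ρ x ≤ dist x p := infDist_le_dist_of_mem hp
    linarith [dist_triangle_right x p z]
  obtain ⟨v, hvt, hvd, hvc⟩ := Vitali.exists_disjoint_subfamily_covering_enlargement_closedBall
    (B \ T) (fun x => x) (fun x => ρ x / 2) R (fun x hx => by linarith [hρlt x hx]) 4 (by norm_num)
  have hcount : v.Countable := by
    refine hvd.countable_of_nonempty_interior fun x hx => ?_
    rw [interior_closedBall _ (by linarith [hρpos x (hvt hx)] : ρ x / 2 ≠ 0)]
    exact ⟨x, mem_ball_self (by linarith [hρpos x (hvt hx)])⟩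
  have hsubset : B \ T ⊆ ⋃ x ∈ v, closedBall x (4 * (ρ x / 2)) := by
    intro x hx
    obtain ⟨p, hp, hxp⟩ := hvc x hx
    exact Set.mem_biUnion hp (hxp (mem_closedBall_self (by linarith [hρpos x hx])))
  have hpoint : ∀ x ∈ v, volume (closedBall x (4 * (ρ x / 2))) ≤ ENNReal.ofReal (48 * (1 + K)) ^ n *
      volume (closedBall x (ρ x / 2) ∩ ((B \ T) ∩ T')) := by
    intro x hx
    have hx0 := hρpos x (hvt hx)
    obtain ⟨x₁, hx₁, hdist⟩ := (infDist_lt_iff hne).1 (by linarith : ρ x < 2 * ρ x)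
    have h1 := hB.volume_closedBall_le hK ha hR hu hB' (hvt hx).1 hx0 (hρlt x (hvt hx)) hx₁.2
      hdist.le
    have h2 : closedBall x (ρ x / 2) ∩ B ∩ T' ⊆ closedBall x (ρ x / 2) ∩ ((B \ T) ∩ T') := by
      rintro p ⟨⟨hp1, hp2⟩, hp3⟩
      refine ⟨hp1, ⟨hp2, fun hpT => ?_⟩, hp3⟩
      have h3 : ρ x ≤ dist x p := infDist_le_dist_of_mem ⟨hp2, hpT⟩
      have h4 : dist p x ≤ ρ x / 2 := hp1
      rw [dist_comm] at h4
      linarith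
    have h3 : volume (closedBall x (4 * (ρ x / 2)))
        = ENNReal.ofReal 48 ^ n * volume (closedBall x (ρ x / 24)) := by
      rw [show 4 * (ρ x / 2) = 48 * (ρ x / 24) by ring,
        Measure.addHaar_closedBall_mul_of_pos _ _ (by norm_num : (0 : ℝ) < 48),
        Measure.addHaar_closedBall_center volume x, finrank_euclideanSpace_fin,
        ENNReal.ofReal_pow (by norm_num)]
    rw [h3, ENNReal.ofReal_mul (by norm_num), mul_pow, mul_assoc]
    gcongr
    exact h1.trans (by gcongr)
  calc volume (B \ T) ≤ volume (⋃ x ∈ v, closedBall x (4 * (ρ x / 2))) := measure_mono hsubset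
    _ ≤ ∑' x : v, volume (closedBall (x : EuclideanSpace ℝ (Fin n)) (4 * (ρ x / 2))) :=
        measure_biUnion_le _ hcount _
    _ ≤ ∑' x : v, ENNReal.ofReal (48 * (1 + K)) ^ n *
          volume (closedBall (x : EuclideanSpace ℝ (Fin n)) (ρ x / 2) ∩ ((B \ T) ∩ T')) :=
        ENNReal.tsum_le_tsum fun x => hpoint x x.2
    _ = ENNReal.ofReal (48 * (1 + K)) ^ n *
          volume (⋃ x ∈ v, closedBall x (ρ x / 2) ∩ ((B \ T) ∩ T')) := by
        rw [ENNReal.tsum_mul_left, measure_biUnion hcount]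
        · exact hvd.mono fun x => Set.inter_subset_left
        · intro x _
          exact measurableSet_closedBall.inter
            ((measurableSet_ball.diff hT.isClosed.measurableSet).inter hT'.isClosed.measurableSet)
    _ ≤ _ := by
        gcongr
        exact Set.iUnion₂_subset fun x _ => Set.inter_subset_right

end Decay

/-! ### Decay of superlevel sets. -/

section Distribution

variable {n : ℕ}

/-- A non-negative continuous supersolution in the unit ball, bounded by `ρ`, with right-hand side
at most `F`. -/
structure IsNonnegSupersolution (ρ lam Lam b F : ℝ) (f u : EuclideanSpace ℝ (Fin n) → ℝ) :
    Prop where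
  supersolution : IsPucciSupersolution ρ lam Lam b f u
  continuousOn : ContinuousOn u (ball 0 1)
  nonneg : ∀ x ∈ ball 0 1, 0 ≤ u x
  abs_le : ∀ x ∈ ball 0 1, |u x| ≤ ρ
  rhs_le : ∀ x ∈ ball 0 1, f x ≤ F

theorem HasBarrier.volumeReal_diff_contactSet_le {K : ℝ} {u : EuclideanSpace ℝ (Fin n) → ℝ}
    {z : EuclideanSpace ℝ (Fin n)} {R a : ℝ} (hK : 1 ≤ K) (ha : 0 < a) (hR : 0 < R)
    (hu : ContinuousOn u (closedBall z (128 * R)))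
    (hB : HasBarrier K u z (128 * R) a) (hB' : HasBarrier K u z (128 * R) ((1 + K) * a))
    (hne : (ball z R ∩ contactSet u z (128 * R) a).Nonempty) :
    volume.real (ball z R \ contactSet u z (128 * R) ((1 + K) * a)) ≤
      (1 - 1 / (2 * (48 * (1 + K)) ^ n)) *
        volume.real (ball z R \ contactSet u z (128 * R) a) := by
  have h := hB.volume_diff_contactSet_le hK ha hR hu hB' hne
  set T := contactSet u z (128 * R) a
  set T' := contactSet u z (128 * R) ((1 + K) * a) with hT'
  set Q := ball z R \ T
  have hQ : volume Q ≠ ⊤ := measure_ne_top_of_subset Set.sdiff_subset measure_ball_lt_top.ne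
  have hTT : T ⊆ T' := contactSet_subset ha.le (by linarith)
  have hQT : ball z R \ T' ⊆ Q \ T' := fun x hx => ⟨⟨hx.1, fun h => hx.2 (hTT h)⟩, hx.2⟩
  have h1 : volume.real (ball z R \ T') ≤ volume.real (Q \ T') :=
    measureReal_mono hQT (measure_ne_top_of_subset Set.sdiff_subset hQ)
  have h2 : volume.real (Q ∩ T') + volume.real (Q \ T') = volume.real Q :=
    measureReal_inter_add_sdiff ((isCompact_contactSet hu _).isClosed.measurableSet) hQ
  have h3 : volume.real Q ≤ (48 * (1 + K)) ^ n * volume.real (Q ∩ T') := by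
    have h4 : ENNReal.ofReal (48 * (1 + K)) ^ n * volume (Q ∩ T') ≠ ⊤ :=
      ENNReal.mul_ne_top (ENNReal.pow_ne_top ENNReal.ofReal_ne_top)
        (measure_ne_top_of_subset Set.inter_subset_left hQ)
    have h5 := ENNReal.toReal_mono h4 h
    rwa [ENNReal.toReal_mul, ENNReal.toReal_pow, ENNReal.toReal_ofReal (by linarith)] at h5
  -- The extra factor `2` in the ratio `1 - 1 / (2 * C)` keeps it positive even when `C = 1`, that
  -- is, for `n = 0`.
  set C := (48 * (1 + K)) ^ n
  have hC : 0 < C := by positivity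
  have h6 : 1 / (2 * C) * volume.real Q ≤ volume.real (Q ∩ T') := by
    rw [one_div, inv_mul_le_iff₀ (by positivity)]
    have : 0 ≤ volume.real (Q ∩ T') := measureReal_nonneg
    nlinarith
  linarith

/-- The opening at stage `k` is `8 * m / R ^ 2 * M ^ k`. At a contact point, comparison with `x₁`
gives `u ≤ m + 262144 * m * M ^ k`, so the superlevel set avoids the contact set. The term `8 * L`
in `H` makes every opening used admissible for the barrier. -/
theorem IsNonnegSupersolution.exists_decay (n : ℕ) {lam Lam : ℝ} (hlam : 0 < lam)
    (hLam : lam ≤ Lam) :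
    ∃ M θ H : ℝ, 1 < M ∧ 0 < θ ∧ θ < 1 ∧ 1 ≤ H ∧
      ∀ (ρ b F m R : ℝ) (f u : EuclideanSpace ℝ (Fin n) → ℝ) (z x₁ : EuclideanSpace ℝ (Fin n)),
      0 ≤ b → IsNonnegSupersolution ρ lam Lam b F f u → 0 < R → 128 * R ≤ 1 → b * (128 * R) ≤ 1 →
      closedBall z (128 * R) ⊆ ball 0 1 → 0 < m → F ≤ m → x₁ ∈ ball z (R / 2) → u x₁ ≤ m →
      ∀ k : ℕ, H * (m * M ^ k) ≤ ρ * R ^ 2 →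
        volume.real (ball z R ∩ {x | H * (m * M ^ k) < u x}) ≤ θ ^ k * volume.real (ball z R) := by
  obtain ⟨K, L, hK, hL, hbar⟩ := IsPucciSupersolution.exists_hasBarrier n hlam hLam
  set C : ℝ := (48 * (1 + K)) ^ n with hC
  have hC1 : 1 ≤ C := one_le_pow₀ (by linarith)
  have hC2 : 1 / (2 * C) ≤ 1 / 2 := one_div_le_one_div_of_le (by norm_num) (by linarith)
  have hC3 : 0 < 1 / (2 * C) := by positivity
  refine ⟨1 + K, 1 - 1 / (2 * C), max (8 * L) 262145, by linarith, by linarith, by linarith,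
    le_max_of_le_right (by norm_num), ?_⟩
  intro ρ b F m R f u z x₁ hb hu hR hR1 hbR hΩ hm hFm hx₁ hx₁m k hk
  have huc : ContinuousOn u (closedBall z (128 * R)) := hu.continuousOn.mono hΩ
  have hball : ball z R ⊆ closedBall z (128 * R) :=
    ball_subset_closedBall.trans (closedBall_subset_closedBall (by linarith))
  have hx₁Ω : x₁ ∈ closedBall z (128 * R) := hball (ball_subset_ball (by linarith) hx₁)
  set a : ℕ → ℝ := fun k => 8 * m / R ^ 2 * (1 + K) ^ k with ha
  have hM : ∀ k, 1 ≤ (1 + K) ^ k := fun k => one_le_pow₀ (by linarith)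
  have haR : ∀ k, a k * R ^ 2 = 8 * (m * (1 + K) ^ k) := fun k => by
    simp only [ha]; field_simp
  have hapos : ∀ k, 0 < a k := fun k => by simp only [ha]; positivity
  have hasucc : ∀ k, a (k + 1) = (1 + K) * a k := fun k => by simp only [ha, pow_succ]; ring
  have hFa : ∀ k, F ≤ a k := by
    intro k
    have h1 : R ^ 2 ≤ 1 := pow_le_one₀ hR.le (by linarith)
    have h2 : a k * R ^ 2 ≤ a k * 1 := mul_le_mul_of_nonneg_left h1 (hapos k).le
    have h3 : m * 1 ≤ m * (1 + K) ^ k := mul_le_mul_of_nonneg_left (hM k) hm.le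
    linarith [haR k]
  have hB : ∀ j, L * a j ≤ ρ → HasBarrier K u z (128 * R) (a j) := fun j hj =>
    hbar ρ b F (128 * R) (a j) f u z hb hu.supersolution huc hΩ hR1 hbR
      (fun x hx => hu.abs_le x (hΩ hx)) (fun x hx => hu.rhs_le x (hΩ hx)) (hapos j) (hFa j) hj
  -- For vertex `z` and opening `a 0`, the value at `x₁` is at most `2 * m`, while outside `ball z
  -- R` it is at least `4 * m`.
  have hne : ∀ j, (ball z R ∩ contactSet u z (128 * R) (a j)).Nonempty := by
    intro j
    induction j with
    | zero =>
      have hz : z ∈ closedBall z (128 * R) := mem_closedBall_self (by linarith)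
      obtain ⟨p, hp, hpmin⟩ := (isCompact_closedBall z (128 * R)).exists_isMinOn
        (f := fun x => u x + a 0 / 2 * ‖x - z‖ ^ 2) ⟨x₁, hx₁Ω⟩
        (huc.fun_add (by fun_prop))
      refine ⟨p, ?_, hp, z, hz, hpmin⟩
      by_contra hout
      have h1 : u p + a 0 / 2 * ‖p - z‖ ^ 2 ≤ u x₁ + a 0 / 2 * ‖x₁ - z‖ ^ 2 := hpmin hx₁Ω
      have h2 : R ≤ ‖p - z‖ := by
        rw [← dist_eq_norm]; exact not_lt.1 hout
      have h3 : ‖x₁ - z‖ ≤ R / 2 := by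
        rw [← dist_eq_norm]; exact (mem_ball.1 hx₁).le
      have ha0 : 0 ≤ a 0 / 2 := by linarith [hapos 0]
      have h4 : a 0 / 2 * R ^ 2 ≤ a 0 / 2 * ‖p - z‖ ^ 2 := by gcongr
      have h5 : a 0 / 2 * ‖x₁ - z‖ ^ 2 ≤ a 0 / 2 * (R / 2) ^ 2 := by gcongr
      have h6 := haR 0
      rw [pow_zero, mul_one] at h6
      have h7 := hu.nonneg p (hΩ hp)
      nlinarith
    | succ j ih =>
      rw [hasucc]
      exact ih.mono (Set.inter_subset_inter_right _ (contactSet_subset (hapos j).le (by linarith)))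
  have hdecay : ∀ j, L * a j ≤ ρ → volume.real (ball z R \ contactSet u z (128 * R) (a j))
      ≤ (1 - 1 / (2 * C)) ^ j * volume.real (ball z R) := by
    intro j
    induction j with
    | zero =>
      intro _
      rw [pow_zero, one_mul]
      exact measureReal_mono Set.sdiff_subset measure_ball_lt_top.ne
    | succ j ih =>
      intro hj
      have hle : L * a j ≤ ρ := by
        refine le_trans ?_ hj
        rw [hasucc]
        have := hapos j
        nlinarith [mul_pos hL this]
      have h1 := (hB j hle).volumeReal_diff_contactSet_le hK (hapos j) hR huc
        (by rw [← hasucc]; exact hB (j + 1) hj) (hne j)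
      rw [← hasucc] at h1
      rw [pow_succ', mul_assoc]
      exact h1.trans (mul_le_mul_of_nonneg_left (ih hle) (by linarith))
  have hmk : 0 < m * (1 + K) ^ k := mul_pos hm (by linarith [hM k])
  have hLk : L * a k ≤ ρ := by
    have h1 : 8 * L * (m * (1 + K) ^ k) ≤ ρ * R ^ 2 :=
      (mul_le_mul_of_nonneg_right (le_max_left _ _) hmk.le).trans hk
    have h2 : (L * a k) * R ^ 2 ≤ ρ * R ^ 2 := by
      rw [mul_assoc, haR]; linarith
    exact le_of_mul_le_mul_right h2 (by positivity)
  refine (measureReal_mono ?_ (measure_ne_top_of_subset Set.sdiff_subset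
    measure_ball_lt_top.ne)).trans (hdecay k hLk)
  rintro x ⟨hxB, hxu⟩
  refine ⟨hxB, ?_⟩
  rintro ⟨hxΩ, y, hy, hmin⟩
  have h1 := hmin x₁ hx₁Ω
  have h2 : ‖x₁ - y‖ ≤ 256 * R := by
    have h3 : dist x₁ z ≤ 128 * R := hx₁Ω
    have h4 : dist y z ≤ 128 * R := hy
    rw [← dist_eq_norm]; linarith [dist_triangle_right x₁ y z]
  have hak : 0 ≤ a k / 2 := by linarith [hapos k]
  have h3 : a k / 2 * ‖x₁ - y‖ ^ 2 ≤ a k / 2 * (256 * R) ^ 2 := by gcongr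
  have h4 : a k / 2 * (256 * R) ^ 2 = 262144 * (m * (1 + K) ^ k) := by
    linear_combination 32768 * haR k
  have h5 : 0 ≤ a k / 2 * ‖x - y‖ ^ 2 := by positivity
  have h6 : m * 1 ≤ m * (1 + K) ^ k := mul_le_mul_of_nonneg_left (hM k) hm.le
  have h7 : 262145 * (m * (1 + K) ^ k) < u x :=
    (mul_le_mul_of_nonneg_right (le_max_right _ _) hmk.le).trans_lt hxu
  linarith

/-- Decay of the distribution function of a supersolution over the quarter ball, with a decay rate
that does not depend on the first-order coefficient `b`. -/
theorem IsNonnegSupersolution.exists_distribution_le (n : ℕ) {lam Lam : ℝ} (hlam : 0 < lam)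
    (hLam : lam ≤ Lam) :
    ∃ M θ : ℝ, 1 < M ∧ 0 < θ ∧ θ < 1 ∧ ∀ b : ℝ, 0 ≤ b → ∃ A J : ℝ, 1 ≤ A ∧ 0 < J ∧
      ∀ (ρ F m : ℝ) (f u : EuclideanSpace ℝ (Fin n) → ℝ) (x₁ : EuclideanSpace ℝ (Fin n)),
      IsNonnegSupersolution ρ lam Lam b F f u → 0 < m → F ≤ m → x₁ ∈ ball 0 (1 / 4) → u x₁ ≤ m →
      ∀ k : ℕ, A * (m * M ^ k) ≤ ρ →
        volume.real (ball 0 (1 / 4) ∩ {x | A * (m * M ^ k) < u x}) ≤ J * θ ^ k := by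
  obtain ⟨M, θ, H, hM, hθ, hθ1, hH, hdec⟩ :=
    IsNonnegSupersolution.exists_decay n hlam hLam
  refine ⟨M, θ, hM, hθ, hθ1, fun b hb => ?_⟩
  -- The coefficient `b` enters only through this radius, hence through `A` and `J` but not `M` and
  -- `θ`.
  set R : ℝ := 1 / (256 * (1 + b)) with hR
  have hR0 : 0 < R := by positivity
  have hRb : R * (1 + b) = 1 / 256 := by rw [hR]; field_simp
  have hR1 : 128 * R ≤ 1 / 2 := by nlinarith [mul_nonneg hR0.le hb]
  have hbR : b * (128 * R) ≤ 1 := by nlinarith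
  -- After `l` stages the superlevel set is too small to contain a ball of half the radius; this
  -- lets an upper bound at one point pass to neighbouring balls.
  obtain ⟨l, hl⟩ := exists_pow_lt_of_lt_one (show (0 : ℝ) < (1 / 2) ^ n by positivity) hθ1
  set K : ℝ := H * M ^ l with hK
  have hMl : ∀ l : ℕ, 1 ≤ M ^ l := fun l => one_le_pow₀ hM.le
  have hK1 : 1 ≤ K := one_le_mul_of_one_le_of_one_le hH (hMl l)
  have hK0 : 0 < K := by linarith
  obtain ⟨N, hN⟩ := exists_nat_ge (1 / R)
  have hN0 : (0 : ℝ) < N := lt_of_lt_of_le (by positivity) hN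
  have hNR : 1 ≤ N * R := by rwa [div_le_iff₀ hR0] at hN
  obtain ⟨Z, hZsub, hZfin, hZcov⟩ := (isCompact_closedBall (0 : EuclideanSpace ℝ (Fin n))
    (1 / 4)).finite_cover_balls hR0
  have hR2 : R ^ 2 ≤ 1 := pow_le_one₀ hR0.le (by linarith)
  have hKN : 1 ≤ K ^ N := one_le_pow₀ hK1
  -- `K ^ N` is the loss along a chain of `N` balls, the extra `K` pays for the level used in each
  -- link, and `R ^ 2` rescales the constraint by `ρ`.
  set A : ℝ := H * K ^ N * K / R ^ 2 with hA
  have hAR : A * R ^ 2 = H * K ^ N * K := div_mul_cancel₀ _ (by positivity)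
  have hA1 : H * K ^ N * K ≤ A := by
    rw [hA, le_div_iff₀ (by positivity)]
    exact mul_le_of_le_one_right (by positivity) hR2
  have hHK : H * K ^ N ≤ H * K ^ N * K := le_mul_of_one_le_right (by positivity) hK1
  have hvR : 0 < volume.real (ball (0 : EuclideanSpace ℝ (Fin n)) R) :=
    ENNReal.toReal_pos (measure_ball_pos _ _ hR0).ne' measure_ball_lt_top.ne
  refine ⟨A, (Z.ncard + 1) * volume.real (ball (0 : EuclideanSpace ℝ (Fin n)) R), ?_,
    by positivity, ?_⟩
  · refine le_trans ?_ hA1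
    exact (one_le_mul_of_one_le_of_one_le hH hKN).trans hHK
  intro ρ F m f u x₁ hu hm hFm hx₁ hx₁m k hk
  have hΩ : ∀ p ∈ closedBall (0 : EuclideanSpace ℝ (Fin n)) (1 / 4),
      closedBall p (128 * R) ⊆ ball 0 1 := fun p hp => by
    refine closedBall_subset_ball' ?_
    linarith [mem_closedBall.1 hp]
  have hHm : A * (m * M ^ k) * R ^ 2 ≤ ρ * R ^ 2 := mul_le_mul_of_nonneg_right hk (by positivity)
  have hHm' : H * K ^ N * K * (m * M ^ k) ≤ ρ * R ^ 2 := by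
    rw [← hAR]; linarith
  have hmk : m ≤ m * M ^ k := le_mul_of_one_le_right hm.le (hMl k)
  have hstep : ∀ (p p' : EuclideanSpace ℝ (Fin n)) (m' : ℝ),
      p ∈ closedBall (0 : EuclideanSpace ℝ (Fin n)) (1 / 4) → dist p' p ≤ R / 2 → m ≤ m' →
      m' ≤ K ^ N * m → (∃ x ∈ ball p (R / 2), u x ≤ m') →
      ∃ x ∈ ball p' (R / 2), u x ≤ K * m' := by
    rintro p p' m' hp hpp hmm' hm'N ⟨x, hx, hxm⟩
    have hm' : 0 < m' := hm.trans_le hmm'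
    by_contra! hcon
    have h1 := hdec ρ b F m' R f u p x hb hu hR0 (by linarith) hbR (hΩ p hp) hm' (by linarith) hx
      hxm l (by
        refine le_trans ?_ hHm'
        calc H * (m' * M ^ l) = K * m' := by rw [hK]; ring
          _ ≤ K * (K ^ N * m) := by gcongr
          _ ≤ H * (K * (K ^ N * m)) := le_mul_of_one_le_left (by positivity) hH
          _ = H * K ^ N * K * m := by ring
          _ ≤ _ := by gcongr)
    have h2 : ball p' (R / 2) ⊆ ball p R ∩ {x | H * (m' * M ^ l) < u x} := by
      intro x' hx'
      refine ⟨?_, ?_⟩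
      · have : dist x' p' < R / 2 := hx'
        rw [mem_ball]; linarith [dist_triangle x' p' p]
      · have := hcon x' hx'
        rw [hK] at this
        change H * (m' * M ^ l) < u x'
        linarith
    have h3 := (measureReal_mono h2 (measure_ne_top_of_subset Set.inter_subset_left
      measure_ball_lt_top.ne)).trans h1
    have h4 : volume.real (ball p' (R / 2)) = (1 / 2) ^ n * volume.real (ball p R) := by
      simp only [measureReal_def]
      rw [show R / 2 = 1 / 2 * R by ring,
        Measure.addHaar_ball_mul_of_pos _ _ (by norm_num : (0 : ℝ) < 1 / 2),
        Measure.addHaar_ball_center volume p, finrank_euclideanSpace_fin, ENNReal.toReal_mul,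
        ENNReal.toReal_ofReal (by positivity)]
    have h5 : 0 < volume.real (ball p R) :=
      ENNReal.toReal_pos (measure_ball_pos _ _ hR0).ne' measure_ball_lt_top.ne
    rw [h4] at h3
    exact absurd (le_of_mul_le_mul_right h3 h5) (not_le.2 hl)
  have hchain : ∀ z ∈ closedBall (0 : EuclideanSpace ℝ (Fin n)) (1 / 4),
      ∃ x ∈ ball z (R / 2), u x ≤ K ^ N * m := by
    intro z hz
    have hx₁' := ball_subset_closedBall hx₁
    have hind : ∀ i : ℕ, i ≤ N →
        ∃ x ∈ ball (AffineMap.lineMap x₁ z ((i : ℝ) / N)) (R / 2), u x ≤ K ^ i * m := by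
      intro i
      induction i with
      | zero =>
        intro _
        refine ⟨x₁, ?_, by simpa using hx₁m⟩
        simpa using hR0
      | succ i ih =>
        intro hi
        rw [pow_succ', mul_assoc]
        refine hstep (AffineMap.lineMap x₁ z ((i : ℝ) / N)) _ (K ^ i * m) ?_ ?_ ?_ ?_
          (ih (by omega))
        · refine (convex_closedBall (0 : EuclideanSpace ℝ (Fin n)) (1 / 4)).lineMap_mem hx₁' hz
            ⟨by positivity, ?_⟩
          rw [div_le_one hN0]
          exact_mod_cast (by omega : i ≤ N)
        · rw [dist_lineMap_lineMap, Real.dist_eq]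
          have h1 : ((i + 1 : ℕ) : ℝ) / N - (i : ℝ) / N = 1 / N := by push_cast; ring
          have h2 : dist x₁ z ≤ 1 / 2 := by
            linarith [dist_triangle_right x₁ z 0, mem_closedBall.1 hz, mem_closedBall.1 hx₁']
          rw [h1, abs_of_pos (by positivity), one_div, inv_mul_le_iff₀ hN0]
          linarith
        · exact le_mul_of_one_le_left hm.le (one_le_pow₀ hK1)
        · have : i ≤ N := by omega
          gcongr
    have := hind N le_rfl
    rwa [div_self hN0.ne', AffineMap.lineMap_apply_one] at this
  have hloc : ∀ z ∈ Z, volume.real (ball z R ∩ {x | A * (m * M ^ k) < u x})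
      ≤ θ ^ k * volume.real (ball (0 : EuclideanSpace ℝ (Fin n)) R) := by
    intro z hz
    obtain ⟨x, hx, hxm⟩ := hchain z (hZsub hz)
    have hmN : m ≤ K ^ N * m := le_mul_of_one_le_left hm.le hKN
    have hMk := hMl k
    have hle : H * (K ^ N * m * M ^ k) ≤ H * K ^ N * K * (m * M ^ k) := by
      calc H * (K ^ N * m * M ^ k) = H * K ^ N * (m * M ^ k) := by ring
        _ ≤ _ := by gcongr
    have h1 := hdec ρ b F (K ^ N * m) R f u z x hb hu hR0 (by linarith) hbR (hΩ z (hZsub hz))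
      (by positivity) (by linarith) hx hxm k (hle.trans hHm')
    have h2 : volume.real (ball z R) = volume.real (ball (0 : EuclideanSpace ℝ (Fin n)) R) := by
      simp only [measureReal_def, Measure.addHaar_ball_center volume z]
    rw [h2] at h1
    refine le_trans (measureReal_mono ?_ (measure_ne_top_of_subset Set.inter_subset_left
      measure_ball_lt_top.ne)) h1
    rintro x' ⟨hx'1, hx'2⟩
    refine ⟨hx'1, lt_of_le_of_lt (hle.trans ?_) hx'2⟩
    exact mul_le_mul_of_nonneg_right hA1 (by positivity)
  have hcover : ball (0 : EuclideanSpace ℝ (Fin n)) (1 / 4) ∩ {x | A * (m * M ^ k) < u x} ⊆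
      ⋃ z ∈ hZfin.toFinset, ball z R ∩ {x | A * (m * M ^ k) < u x} := by
    rintro x ⟨hx1, hx2⟩
    obtain ⟨z, hz, hxz⟩ := Set.mem_iUnion₂.1 (hZcov (ball_subset_closedBall hx1))
    exact Set.mem_biUnion ((Set.Finite.mem_toFinset hZfin).2 hz) ⟨hxz, hx2⟩
  have hne : volume (⋃ z ∈ hZfin.toFinset, ball z R ∩ {x | A * (m * M ^ k) < u x}) ≠ ⊤ := by
    refine ((measure_biUnion_finset_le _ _).trans_lt (ENNReal.sum_lt_top.2 fun z _ => ?_)).ne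
    exact (measure_mono Set.inter_subset_left).trans_lt measure_ball_lt_top
  calc _ ≤ _ := measureReal_mono hcover hne
    _ ≤ ∑ z ∈ hZfin.toFinset, volume.real (ball z R ∩ {x | A * (m * M ^ k) < u x}) :=
        measureReal_biUnion_finset_le _ _
    _ ≤ ∑ z ∈ hZfin.toFinset, θ ^ k * volume.real (ball (0 : EuclideanSpace ℝ (Fin n)) R) :=
        Finset.sum_le_sum fun z hz => hloc z ((Set.Finite.mem_toFinset hZfin).1 hz)
    _ = Z.ncard * (θ ^ k * volume.real (ball (0 : EuclideanSpace ℝ (Fin n)) R)) := by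
        rw [Finset.sum_const, nsmul_eq_mul, Set.ncard_eq_toFinset_card Z hZfin]
    _ ≤ (Z.ncard + 1) * (θ ^ k * volume.real (ball (0 : EuclideanSpace ℝ (Fin n)) R)) := by
        gcongr; linarith
    _ = _ := by ring

end Distribution

/-! ### From level-set decay to the integral estimate. -/

/-- A discrete layer-cake bound: each point is charged to the first level `t * M ^ k` not exceeded
by `g`, and the resulting series is geometric with ratio `M ^ ε * θ`. -/
theorem lintegral_rpow_le_of_geometric_levels {α : Type*} [MeasurableSpace α] {μ : Measure α}
    {B : Set α} (hBm : MeasurableSet B) (hB : μ B ≠ ⊤) {g : α → ℝ} {t M θ ε J : ℝ} {E : ℕ → Set α}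
    (ht : 0 < t) (hM : 1 < M) (hθ : 0 < θ) (hε : 0 < ε) (hJ : 0 ≤ J) (hMθ : M ^ ε * θ < 1)
    (hg : ∀ x ∈ B, 0 ≤ g x) (hEm : ∀ k, MeasurableSet (E k)) (hE : ∀ k, μ (E k ∩ B) ≤
      ENNReal.ofReal (J * θ ^ k)) (hgE : ∀ k, ∀ x ∈ B, t * M ^ k < g x → x ∈ E k) :
    ∫⁻ x in B, ‖g x‖ₑ ^ ε ∂μ ≤
      ENNReal.ofReal (t ^ ε * (μ.real B + J * M ^ ε * (1 - M ^ ε * θ)⁻¹)) := by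
  set κ : ℝ := M ^ ε with hκ
  have hκ0 : 0 < κ := Real.rpow_pos_of_pos (by linarith) _
  have hpow : ∀ k : ℕ, (t * M ^ k) ^ ε = t ^ ε * κ ^ k := fun k => by
    have hM0 : (0 : ℝ) ≤ M := by linarith
    rw [Real.mul_rpow ht.le (by positivity), hκ, ← Real.rpow_natCast, ← Real.rpow_natCast,
      ← Real.rpow_mul hM0, ← Real.rpow_mul hM0, mul_comm ε]
  have hpt : ∀ x ∈ B, ‖g x‖ₑ ^ ε ≤ ENNReal.ofReal (t ^ ε) *
      (1 + ∑' k, ENNReal.ofReal (κ ^ (k + 1)) * (E k).indicator 1 x) := by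
    intro x hx
    have hgx := hg x hx
    rw [Real.enorm_of_nonneg hgx, ENNReal.ofReal_rpow_of_nonneg hgx hε.le]
    obtain ⟨k₀, hk₀⟩ : ∃ k : ℕ, g x ≤ t * M ^ k := by
      obtain ⟨k, hk⟩ := pow_unbounded_of_one_lt (g x / t) hM
      refine ⟨k, ?_⟩
      rw [div_lt_iff₀ ht] at hk
      linarith
    have hex : ∃ k : ℕ, g x ≤ t * M ^ k := ⟨k₀, hk₀⟩
    classical
    have hspec := Nat.find_spec hex
    have hmin := fun k => @Nat.find_min _ _ hex k
    cases hk : Nat.find hex with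
    | zero =>
      rw [hk, pow_zero, mul_one] at hspec
      calc ENNReal.ofReal (g x ^ ε) ≤ ENNReal.ofReal (t ^ ε) * 1 := by
            rw [mul_one]; gcongr
        _ ≤ _ := by gcongr; exact le_self_add
    | succ k =>
      rw [hk] at hspec
      have hkE : x ∈ E k := hgE k x hx (not_le.1 (hmin k (by omega)))
      have h1 : g x ^ ε ≤ t ^ ε * κ ^ (k + 1) := by
        rw [← hpow]; gcongr
      calc ENNReal.ofReal (g x ^ ε) ≤ ENNReal.ofReal (t ^ ε) *
            (ENNReal.ofReal (κ ^ (k + 1)) * (E k).indicator 1 x) := by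
            rw [Set.indicator_of_mem hkE, Pi.one_apply, mul_one,
              ← ENNReal.ofReal_mul (by positivity)]
            gcongr
        _ ≤ _ := by
            gcongr
            exact (ENNReal.le_tsum k).trans le_add_self
  have hsum : HasSum (fun k => J * κ * (κ * θ) ^ k) (J * κ * (1 - κ * θ)⁻¹) :=
    (hasSum_geometric_of_lt_one (by positivity) hMθ).mul_left _
  calc ∫⁻ x in B, ‖g x‖ₑ ^ ε ∂μ
      ≤ ∫⁻ x in B, ENNReal.ofReal (t ^ ε) *
          (1 + ∑' k, ENNReal.ofReal (κ ^ (k + 1)) * (E k).indicator 1 x) ∂μ :=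
        setLIntegral_mono' hBm hpt
    _ = ENNReal.ofReal (t ^ ε) * (μ B + ∑' k, ENNReal.ofReal (κ ^ (k + 1)) * μ (E k ∩ B)) := by
        have hmeas : ∀ k, Measurable fun x =>
            ENNReal.ofReal (κ ^ (k + 1)) * (E k).indicator (1 : α → ENNReal) x :=
          fun k => (measurable_one.indicator (hEm k)).const_mul _
        have hmeas' : Measurable fun x =>
            ∑' k, ENNReal.ofReal (κ ^ (k + 1)) * (E k).indicator (1 : α → ENNReal) x :=
          Measurable.tsum hmeas
        rw [lintegral_const_mul _ (hmeas'.const_add 1),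
          lintegral_add_left measurable_const, lintegral_tsum fun k => (hmeas k).aemeasurable]
        congr 2
        · simp
        · refine tsum_congr fun k => ?_
          rw [lintegral_const_mul _ (measurable_one.indicator (hEm k)),
            lintegral_indicator_one (hEm k), Measure.restrict_apply (hEm k)]
    _ ≤ ENNReal.ofReal (t ^ ε) *
          (μ B + ∑' k, ENNReal.ofReal (J * κ * (κ * θ) ^ k)) := by
        gcongr with k
        calc _ ≤ ENNReal.ofReal (κ ^ (k + 1)) * ENNReal.ofReal (J * θ ^ k) := by
              gcongr; exact hE k
          _ = _ := by
              rw [← ENNReal.ofReal_mul (by positivity)]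
              congr 1; ring
    _ = _ := by
        have h1 : 0 ≤ J * κ * (1 - κ * θ)⁻¹ := by
          have : 0 < 1 - κ * θ := by linarith
          positivity
        rw [← ENNReal.ofReal_tsum_of_nonneg (fun k => by positivity) hsum.summable, hsum.tsum_eq,
          ENNReal.ofReal_mul (p := t ^ ε) (by positivity), ENNReal.ofReal_add measureReal_nonneg h1,
          ofReal_measureReal hB]

theorem exists_rpow_mul_lt_one {M θ : ℝ} (hM : 1 < M) (hθ : 0 < θ) (hθ1 : θ < 1) :
    ∃ ε : ℝ, 0 < ε ∧ M ^ ε * θ < 1 := by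
  have h : Filter.Tendsto (fun ε : ℝ => M ^ ε * θ) (𝓝[>] 0) (𝓝 (M ^ (0 : ℝ) * θ)) := by
    refine Filter.Tendsto.mono_left ?_ nhdsWithin_le_nhds
    exact ((Real.continuous_const_rpow (by linarith : M ≠ 0)).mul continuous_const).tendsto 0
  rw [Real.rpow_zero, one_mul] at h
  obtain ⟨ε, hε, hε0⟩ := ((h.eventually (gt_mem_nhds hθ1)).and self_mem_nhdsWithin).exists
  exact ⟨ε, hε0, hε⟩

theorem theorem2 (n : ℕ) (hn : 1 ≤ n) (lam Lam : ℝ) (hlam : 0 < lam) (hLam : lam ≤ Lam) :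
    ∃ ε₀ : ℝ, 0 < ε₀ ∧ ∀ b₀ : ℝ, 0 ≤ b₀ →
      ∃ C : ℝ, 0 < C ∧
        ∀ (ρ : ℝ) (f u : EuclideanSpace ℝ (Fin n) → ℝ),
          pucciRho₀ n lam Lam b₀ ≤ ρ →
          ContinuousOn u (ball (0 : EuclideanSpace ℝ (Fin n)) 1) →
          IsPucciSupersolution ρ lam Lam b₀ f u →
          (∀ x ∈ ball (0 : EuclideanSpace ℝ (Fin n)) 1, 0 ≤ u x) →
          (∀ x ∈ ball (0 : EuclideanSpace ℝ (Fin n)) 1, |u x| ≤ ρ) →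
          BddAbove ((fun x => |f x|) '' ball (0 : EuclideanSpace ℝ (Fin n)) 1) →
          infQuarterBall u + supNormUnitBall f / 8 ≤ ρ / pucciRho₀ n lam Lam b₀ →
          eLpNorm (truncAbove (17 * ρ / pucciRho₀ n lam Lam b₀) u) (ENNReal.ofReal ε₀)
              (volume.restrict (ball (0 : EuclideanSpace ℝ (Fin n)) (1 / 4)))
            ≤ ENNReal.ofReal (C * (infQuarterBall u + supNormUnitBall f)) := by
  obtain ⟨M, θ, hM, hθ, hθ1, hdist⟩ :=
    IsNonnegSupersolution.exists_distribution_le n hlam hLam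
  obtain ⟨ε, hε, hεθ⟩ := exists_rpow_mul_lt_one hM hθ hθ1
  refine ⟨ε, hε, fun b hb => ?_⟩
  obtain ⟨A, J, hA, hJ, hAJ⟩ := hdist b hb
  set B : Set (EuclideanSpace ℝ (Fin n)) := ball 0 (1 / 4) with hB
  have hMε : 0 < M ^ ε := Real.rpow_pos_of_pos (by linarith) _
  set W : ℝ := volume.real B + J * M ^ ε * (1 - M ^ ε * θ)⁻¹ with hW
  have hW0 : 0 < W := by
    have h1 : 0 < 1 - M ^ ε * θ := by linarith
    have h2 : 0 < J * M ^ ε * (1 - M ^ ε * θ)⁻¹ := by positivity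
    have h3 : 0 ≤ volume.real B := measureReal_nonneg
    linarith
  have hA0 : 0 < A := by linarith
  refine ⟨A * W ^ (1 / ε), by positivity, ?_⟩
  intro ρ f u _ huc hu hu0 huρ hf _
  have hB1 : B ⊆ ball 0 1 := ball_subset_ball (by norm_num)
  set g := truncAbove (17 * ρ / pucciRho₀ n lam Lam b) u with hg
  have hg0 : ∀ x ∈ B, 0 ≤ g x := by
    intro x hx
    simp only [hg, truncAbove]
    split_ifs
    exacts [hu0 x (hB1 hx), le_rfl]
  have hgu : ∀ x ∈ B, g x ≤ u x := by
    intro x hx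
    simp only [hg, truncAbove]
    split_ifs
    exacts [le_rfl, hu0 x (hB1 hx)]
  have hF : ∀ x ∈ ball (0 : EuclideanSpace ℝ (Fin n)) 1, |f x| ≤ supNormUnitBall f := fun x hx =>
    le_csSup hf ⟨x, hx, rfl⟩
  have hF0 : 0 ≤ supNormUnitBall f :=
    (abs_nonneg _).trans (hF 0 (mem_ball_self one_pos))
  have hBne : (u '' B).Nonempty := ⟨u 0, 0, mem_ball_self (by norm_num), rfl⟩
  have hI0 : 0 ≤ infQuarterBall u :=
    le_csInf hBne (by rintro _ ⟨x, hx, rfl⟩; exact hu0 x (hB1 hx))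
  have hS : IsNonnegSupersolution ρ lam Lam b (supNormUnitBall f) f u :=
    ⟨hu, huc, hu0, huρ, fun x hx => (le_abs_self _).trans (hF x hx)⟩
  -- The `δ` makes `m` positive and provides a point where `u ≤ m`, since the infimum need not be
  -- attained.
  have main : ∀ δ : ℝ, 0 < δ → eLpNorm g (ENNReal.ofReal ε) (volume.restrict B) ≤
      ENNReal.ofReal (A * W ^ (1 / ε) * (infQuarterBall u + supNormUnitBall f + δ)) := by
    intro δ hδ
    set m := infQuarterBall u + supNormUnitBall f + δ with hm
    have hm0 : 0 < m := by linarith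
    obtain ⟨_, ⟨x₁, hx₁, rfl⟩, hx₁u⟩ := exists_lt_of_csInf_lt hBne
      (show infQuarterBall u < infQuarterBall u + δ by linarith)
    have hx₁m : u x₁ ≤ m := by linarith
    -- Decay is known only for levels up to `ρ`; higher superlevel sets are empty since `u ≤ ρ`.
    set E : ℕ → Set (EuclideanSpace ℝ (Fin n)) := fun k =>
      if A * (m * M ^ k) ≤ ρ then B ∩ {x | A * (m * M ^ k) < u x} else ∅ with hE
    have hEm : ∀ k, MeasurableSet (E k) := by
      intro k
      simp only [hE]
      split_ifs
      · exact ((huc.mono hB1).isOpen_inter_preimage isOpen_ball isOpen_Ioi).measurableSet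
      · exact MeasurableSet.empty
    have hEμ : ∀ k, volume (E k ∩ B) ≤ ENNReal.ofReal (J * θ ^ k) := by
      intro k
      simp only [hE]
      split_ifs with h
      · have hfin : volume (B ∩ {x | A * (m * M ^ k) < u x}) ≠ ⊤ :=
          measure_ne_top_of_subset Set.inter_subset_left measure_ball_lt_top.ne
        refine (measure_mono Set.inter_subset_left).trans ?_
        rw [← ofReal_measureReal hfin]
        exact ENNReal.ofReal_le_ofReal
          (hAJ ρ _ m f u x₁ hS hm0 (by linarith) hx₁ hx₁m k h)
      · simp
    have hgE : ∀ k, ∀ x ∈ B, A * m * M ^ k < g x → x ∈ E k := by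
      intro k x hx hlt
      rw [mul_assoc] at hlt
      have h1 := hlt.trans_le (hgu x hx)
      have h2 := (le_abs_self _).trans (huρ x (hB1 hx))
      simp only [hE]
      rw [if_pos (h1.le.trans h2)]
      exact ⟨hx, h1⟩
    have hint := lintegral_rpow_le_of_geometric_levels (μ := volume) (B := B) measurableSet_ball
      measure_ball_lt_top.ne (mul_pos hA0 hm0) hM hθ hε hJ.le hεθ hg0 hEm hEμ hgE
    rw [eLpNorm_eq_lintegral_rpow_enorm_toReal (by simpa using hε) ENNReal.ofReal_ne_top,
      ENNReal.toReal_ofReal hε.le]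
    refine (ENNReal.rpow_le_rpow hint (by positivity)).trans (le_of_eq ?_)
    have hAm : 0 ≤ A * m := by positivity
    rw [ENNReal.ofReal_rpow_of_nonneg (by positivity) (by positivity),
      Real.mul_rpow (by positivity) hW0.le, ← Real.rpow_mul hAm, mul_one_div_cancel hε.ne',
      Real.rpow_one]
    congr 1
    ring
  have hlim : Filter.Tendsto (fun δ : ℝ => ENNReal.ofReal
      (A * W ^ (1 / ε) * (infQuarterBall u + supNormUnitBall f + δ))) (𝓝[>] 0)
      (𝓝 (ENNReal.ofReal (A * W ^ (1 / ε) * (infQuarterBall u + supNormUnitBall f + 0)))) := by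
    refine Filter.Tendsto.mono_left (Continuous.tendsto ?_ 0) nhdsWithin_le_nhds
    exact ENNReal.continuous_ofReal.comp (by fun_prop)
  rw [add_zero] at hlim
  exact ge_of_tendsto hlim (by filter_upwards [self_mem_nhdsWithin] with δ hδ using main δ hδ)
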